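/- Let $\mathbb K$ be a field of characteristic $0$ and let $\mathfrak g$ be a finite-dimensional Lie algebra over $\mathbb K$ with trivial center. Put $\mathfrak g_0=\mathfrak g$ and $\mathfrak g_{n+1}=\mathrm{Der}\,\mathfrak g_n$. Then this derivation tower terminates: there is an $N$ such that $\mathrm{ad}:\mathfrak g_n\to\mathfrak g_{n+1}$ is bijective for all $n\ge N$. Let $\widehat{\mathfrak g}=\mathfrak g_N$ be its limit for any such $N$; it is a finite-dimensional complete Lie algebra (trivial center, all derivations inner). Let $C^\infty(\mathfrak g)$ be the intersection of the terms of the lower central series of $\mathfrak g$, and let $Z(\cdot)$ denote the center. Let $(\mathfrak s,\mathfrak k,\mathfrak m)$ be a $\Gamma$-triple of $\mathfrak g$, that is: $\mathfrak s$ is a Levi subalgebra of $\mathfrak g$; $\mathfrak k$ is a nilpotent subalgebra of $\mathfrak g$ with $[\mathfrak s,\mathfrak k]=0$; and $\mathfrak m$ is a subspace of the radical $\mathfrak r$ of $\mathfrak g$ with $\mathfrak r=\mathfrak m\oplus\mathfrak k$ and $[\mathfrak s\oplus\mathfrak k,\mathfrak m]=\mathfrak m$ (so that $\mathfrak g=\mathfrak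 s\oplus\mathfrak k\oplus\mathfrak m$). Let $\Gamma=\mathrm{ad}\,\mathfrak s+(\mathrm{ad}\,\mathfrak k)_S\subset\mathfrak{gl}(\mathfrak g)$, where $(\mathrm{ad}\,\mathfrak k)_S$ is the set of semisimple Jordan components of the endomorphisms $\mathrm{ad}\,x$, $x\in\mathfrak k$. Let $\hat{\mathfrak n}$ be the Lie subalgebra of $\mathfrak g$ generated by $\mathfrak m$, let $(\mathrm{Der}\,\hat{\mathfrak n})^\Gamma$ be the set of derivations of $\hat{\mathfrak n}$ that commute with the restriction of $\Gamma$ to $\hat{\mathfrak n}$, and let $\mathfrak B=(\mathrm{Der}\,\hat{\mathfrak n})^\Gamma|_{\mathfrak m}\subset\mathfrak{gl}(\mathfrak m)$. Then $$\dim\widehat{\mathfrak g}\ \le\ \dim(\mathfrak s\oplus\mathfrak B\oplus\mathfrak m)\ \le\ \dim\mathrm{Der}\,(C^\infty(\mathfrak g))+\dim Z(C^\infty(\mathfrak g)).$$ In particular (Schenkman's bound), $\dim\widehat{\mathfrak g}\le\dim\mathrm{Der}\,(C^\infty(\mathfrak g))+\dim Z(C^\infty(\mathfrak g))$; this last bound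 holds without reference to a $\Gamma$-triple. -/

import Mathlib

universe u v

/-- A Lie algebra over `K`, bundled with its carrier type. -/
structure BundledLieAlgebra (K : Type u) [CommRing K] where
  carrier : Type v
  [lieRing : LieRing carrier]
  [lieAlgebra : LieAlgebra K carrier]

attribute [instance] BundledLieAlgebra.lieRing BundledLieAlgebra.lieAlgebra

/-- The tower of derivation algebras of `g`: it starts with `g`, and each further term is the
Lie algebra of derivations of the preceding one. -/
def derivationTower (K : Type u) [Field K] (g : Type v) [LieRing g] [LieAlgebra K g] :
    ℕ → BundledLieAlgebra.{u, v} K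
  | 0 => ⟨g⟩
  | n + 1 => ⟨LieDerivation K (derivationTower K g n).carrier (derivationTower K g n).carrier⟩

/-- The derivation tower of `g` terminates at its `N`-th term: from `N` on, each canonical map
`ad : g_n → Der g_n = g_(n+1)` is bijective. The limit of the tower is then `g_N`. -/
def DerivationTowerTerminatesAt (K : Type u) [Field K] (g : Type v) [LieRing g] [LieAlgebra K g]
    (N : ℕ) : Prop :=
  ∀ n, N ≤ n → Function.Bijective (LieDerivation.ad K (derivationTower K g n).carrier)

/-- A complete Lie algebra: its center is trivial and all its derivations are inner. -/
def IsCompleteLieAlgebra (K : Type u) [Field K] (L : Type v) [LieRing L] [LieAlgebra K L] :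
    Prop :=
  LieAlgebra.center K L = ⊥ ∧ ∀ D : LieDerivation K L L, ∃ x : L, LieDerivation.ad K L x = D

/-- The ideal `C^∞(g)`, the intersection of the terms of the lower central series of `g`. -/
def lowerCentralLimit (K : Type u) [Field K] (g : Type v) [LieRing g] [LieAlgebra K g] :
    LieIdeal K g :=
  ⨅ p : ℕ, LieModule.lowerCentralSeries K g g p

/-- A `Γ`-triple `(s, k, m)` of `g`. The decomposition `g = s ⊕ k ⊕ m` of vector spaces is a
consequence of the fields `levi`, `disjoint` and `sup_eq`. -/
structure IsGammaTriple (K : Type u) [Field K] {g : Type v} [LieRing g] [LieAlgebra K g]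
    (s k : LieSubalgebra K g) (m : Submodule K g) : Prop where
  /-- `s` is a Levi subalgebra: a subalgebra complementary to the radical. -/
  levi : IsCompl s.toSubmodule (LieAlgebra.radical K g).toSubmodule
  /-- `k` is a nilpotent subalgebra. -/
  nilpotent : LieRing.IsNilpotent k
  /-- `[s, k] = 0`. -/
  lie_eq_zero : ∀ x ∈ s, ∀ y ∈ k, ⁅x, y⁆ = 0
  /-- The radical is the direct sum of `m` and `k`. -/
  disjoint : Disjoint m k.toSubmodule
  sup_eq : m ⊔ k.toSubmodule = (LieAlgebra.radical K g).toSubmodule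
  /-- `[s ⊕ k, m] = m`. -/
  lie_eq : Submodule.span K
    {z : g | ∃ x ∈ s.toSubmodule ⊔ k.toSubmodule, ∃ y ∈ m, ⁅x, y⁆ = z} = m

/-- `Γ = ad s + (ad k)_S`, where `(ad k)_S` consists of the semisimple components of the Jordan
decompositions of the endomorphisms `ad x` of `g`, for `x` in `k`. -/
def gammaOf (K : Type u) [Field K] {g : Type v} [LieRing g] [LieAlgebra K g]
    (s k : LieSubalgebra K g) : Submodule K (Module.End K g) :=
  Submodule.span K {u | ∃ x ∈ s, LieAlgebra.ad K g x = u} ⊔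
    Submodule.span K {u | ∃ x ∈ k, ∃ v : Module.End K g,
      u.IsSemisimple ∧ IsNilpotent v ∧ Commute u v ∧ LieAlgebra.ad K g x = u + v}

/-- The Lie subalgebra of `g` generated by `m`, written `n̂`. -/
def nHat (K : Type u) [Field K] {g : Type v} [LieRing g] [LieAlgebra K g]
    (m : Submodule K g) : LieSubalgebra K g :=
  LieSubalgebra.lieSpan K g (m : Set g)

/-- `(Der n̂)^Γ`: the derivations of `n̂` that commute with the restrictions to `n̂` of the
elements of `Γ`. -/
def derCentralizer (K : Type u) [Field K] {g : Type v} [LieRing g] [LieAlgebra K g]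
    (s k : LieSubalgebra K g) (m : Submodule K g) :
    Submodule K (LieDerivation K (nHat K m) (nHat K m)) where
  carrier := {D | ∀ γ ∈ gammaOf K s k, ∀ x y : nHat K m, γ (x : g) = (y : g) →
    γ (D x : g) = (D y : g)}
  zero_mem' := by
    intro γ _ x y _
    simp
  add_mem' := by
    intro D E hD hE γ hγ x y hxy
    simp [hD γ hγ x y hxy, hE γ hγ x y hxy]
  smul_mem' := by
    intro c D hD γ hγ x y hxy
    simp [hD γ hγ x y hxy]

/-- `B = (Der n̂)^Γ|_m`: the endomorphisms of `m` that are restrictions of elements of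
`(Der n̂)^Γ`. -/
def gammaB (K : Type u) [Field K] {g : Type v} [LieRing g] [LieAlgebra K g]
    (s k : LieSubalgebra K g) (m : Submodule K g) : Submodule K (Module.End K m) where
  carrier := {b | ∃ D ∈ derCentralizer K s k m,
    ∀ x : m, ((b x : m) : g) = (D ⟨(x : g), LieSubalgebra.subset_lieSpan x.2⟩ : nHat K m)}
  zero_mem' := ⟨0, Submodule.zero_mem _, by simp⟩
  add_mem' := by
    rintro b c ⟨D, hD, hb⟩ ⟨E, hE, hc⟩
    exact ⟨D + E, Submodule.add_mem _ hD hE, fun x => by simp [hb x, hc x]⟩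
  smul_mem' := by
    rintro c b ⟨D, hD, hb⟩
    exact ⟨c • D, Submodule.smul_mem _ c hD, fun x => by simp [hb x]⟩

open LieModule Module.End

namespace LieModule

variable {K : Type*} [Field K]

/-- A perfect Lie algebra acts trivially on each nilpotent module. -/
lemma lie_mem_lowerCentralSeries_of_perfect {S V : Type*} [LieRing S] [LieAlgebra K S]
    [AddCommGroup V] [Module K V] [LieRingModule S V] [LieModule K S V]
    (hS : lowerCentralSeries K S S 1 = ⊤) (n : ℕ) :
    ∀ (x : S) (v : V), ⁅x, v⁆ ∈ lowerCentralSeries K S V n := by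
  induction n with
  | zero => simp
  | succ n ih =>
    intro x
    have hx : x ∈ lowerCentralSeries K S S 1 := by rw [hS]; trivial
    rw [lowerCentralSeries_succ, ← LieSubmodule.mem_toSubmodule,
      LieSubmodule.lieIdeal_oper_eq_linear_span'] at hx
    induction hx using Submodule.span_induction with
    | mem x hx =>
      obtain ⟨y, -, z, -, rfl⟩ := hx
      intro v
      rw [lie_lie, lowerCentralSeries_succ]
      exact sub_mem (LieSubmodule.lie_mem_lie trivial (ih _ _))
        (LieSubmodule.lie_mem_lie trivial (ih _ _))
    | zero => simp
    | add x y _ _ hx hy => intro v; rw [add_lie]; exact add_mem (hx v) (hy v)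
    | smul c x _ hx => intro v; rw [smul_lie]; exact SMulMemClass.smul_mem c (hx v)

end LieModule

namespace LieAlgebra

variable {K S : Type*} [Field K] [CharZero K] [LieRing S] [LieAlgebra K S]
  [FiniteDimensional K S] [HasTrivialRadical K S]

/-- An ideal of a semisimple Lie algebra is perfect. -/
lemma lie_self_eq_of_hasTrivialRadical (I : LieIdeal K S) : ⁅I, I⁆ = I := by
  have hle : ⁅I, I⁆ ≤ I := LieSubmodule.lie_le_left I I
  have hc := LieIdeal.isCompl_killingCompl (K := K) ⁅I, I⁆
  have hQ : I ⊓ (⁅I, I⁆ : LieIdeal K S).killingCompl = ⊥ := by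
    suffices IsLieAbelian (I ⊓ (⁅I, I⁆ : LieIdeal K S).killingCompl : LieIdeal K S) from
      IsKilling.ideal_eq_bot_of_isLieAbelian _
    rw [LieSubmodule.lie_abelian_iff_lie_self_eq_bot, ← le_bot_iff, ← hc.inf_eq_bot]
    refine le_inf ?_ ((LieSubmodule.lie_le_left _ _).trans inf_le_right)
    exact LieSubmodule.mono_lie inf_le_left inf_le_left
  refine le_antisymm hle ?_
  calc I = (⁅I, I⁆ ⊔ (⁅I, I⁆ : LieIdeal K S).killingCompl) ⊓ I := by rw [hc.sup_eq_top, top_inf_eq]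
    _ = ⁅I, I⁆ ⊔ (⁅I, I⁆ : LieIdeal K S).killingCompl ⊓ I := (sup_inf_assoc_of_le _ hle)
    _ ≤ _ := by rw [inf_comm, hQ, sup_bot_eq]

variable {V : Type*} [AddCommGroup V] [Module K V] [LieRingModule S V] [LieModule K S V]
  [FiniteDimensional K V]

/-- An element of a semisimple Lie algebra that is orthogonal to all others for the trace form of a
module acts trivially on this module. -/
lemma toEnd_eq_zero_of_traceForm_eq_zero {x : S} (hx : ∀ y, traceForm K S V x y = 0) :
    toEnd K S V x = 0 := by
  let I : LieIdeal K S :=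
    { LinearMap.ker (traceForm K S V) with
      lie_mem := by
        intro y z hz
        ext w
        have : traceForm K S V z = 0 := hz
        rw [traceForm_comm, ← traceForm_apply_lie_apply, traceForm_comm, this]
        simp }
  have hxI : x ∈ I := by
    change traceForm K S V x = 0
    ext y
    exact hx y
  have htr : traceForm K I V = 0 := by
    ext ⟨y, hy⟩ ⟨z, hz⟩
    have : traceForm K S V y = 0 := hy
    exact LinearMap.congr_fun this z
  have hperf : derivedSeries K I 1 = ⊤ := by
    rw [LieIdeal.derivedSeries_eq_derivedSeriesOfIdeal_comap, derivedSeriesOfIdeal_succ,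
      derivedSeriesOfIdeal_zero, lie_self_eq_of_hasTrivialRadical]
    simp
  have hnil := isNilpotent_derivedSeries_of_traceForm_eq_zero htr
  have hnil' : LieModule.IsNilpotent I V := by
    rw [LieModule.isNilpotent_iff_forall' (R := K)] at hnil ⊢
    intro y
    exact hnil ⟨y, by rw [hperf]; trivial⟩
  obtain ⟨k, hk⟩ := hnil'.nilpotent K
  ext v
  have hp : lowerCentralSeries K I I 1 = ⊤ := hperf
  have := lie_mem_lowerCentralSeries_of_perfect hp k (⟨x, hxI⟩ : I) v
  rw [hk] at this
  simpa using this

/-- The Casimir endomorphism: it commutes with the action, its image lies in `[S, V]`, and its trace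
is not zero unless the action is trivial. -/
lemma exists_casimir (h : ¬ LieModule.IsTrivial S V) :
    ∃ Ω : Module.End K V, (∀ (x : S) (v : V), Ω ⁅x, v⁆ = ⁅x, Ω v⁆) ∧
      (∀ v, Ω v ∈ lowerCentralSeries K S V 1) ∧ (∀ v, (∀ x : S, ⁅x, v⁆ = 0) → Ω v = 0) ∧
      LinearMap.trace K V Ω ≠ 0 := by
  let E : Submodule K (Module.End K V) := LinearMap.range (toEnd K S V : S →ₗ[K] Module.End K V)
  let B : LinearMap.BilinForm K E :=
    LinearMap.mk₂ K (fun a b => LinearMap.trace K V ((a : Module.End K V) * b))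
      (by intros; simp [add_mul]) (by intros; simp)
      (by intros; simp [mul_add]) (by intros; simp)
  have hBapp : ∀ a b : E, B a b = LinearMap.trace K V ((a : Module.End K V) * b) := fun _ _ => rfl
  have hsym : B.IsSymm := ⟨fun a b => by simp [hBapp, LinearMap.trace_mul_comm K (a : Module.End K V)]⟩
  have hnd : B.Nondegenerate := by
    refine hsym.isRefl.nondegenerate_iff_separatingLeft.mpr ?_
    rintro ⟨-, x, rfl⟩ ha
    apply Subtype.ext
    exact toEnd_eq_zero_of_traceForm_eq_zero (fun y => ha ⟨_, y, rfl⟩)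
  let b := Module.finBasis K E
  let b' := B.dualBasis hnd b
  have hlie : ∀ (x : S) (a : E), toEnd K S V x * a - a * toEnd K S V x ∈ E := by
    rintro x ⟨-, y, rfl⟩
    exact ⟨⁅x, y⁆, by simp [LieRing.of_associative_ring_bracket]⟩
  let δ : S → E → E := fun x a => ⟨_, hlie x a⟩
  have hδ : ∀ x a, ((δ x a : E) : Module.End K V) = toEnd K S V x * a - a * toEnd K S V x :=
    fun _ _ => rfl
  have hinv : ∀ x a c, B (δ x a) c = - B a (δ x c) := by
    intro x a c
    have h1 := LinearMap.trace_mul_comm K (toEnd K S V x) ((a : Module.End K V) * c)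
    simp only [hBapp, hδ, sub_mul, mul_sub, map_sub, mul_assoc] at h1 ⊢
    linear_combination h1
  let Ω : Module.End K V := ∑ i, (b i : Module.End K V) * b' i
  have hexp : ∀ a : E, a = ∑ j, B (b' j) a • b j := by
    intro a
    apply b.ext_elem
    intro i
    simp only [map_sum, map_smul, Finsupp.coe_finsetSum, Finset.sum_apply, Finsupp.smul_apply,
      Module.Basis.repr_self, smul_eq_mul]
    rw [Finset.sum_eq_single i (by intro j _ hj; simp [hj]) (by simp)]
    have := LinearMap.BilinForm.dualBasis_repr_apply hnd b' a i
    rw [LinearMap.BilinForm.dualBasis_dualBasis hnd hsym] at this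
    simpa using this.trans (hsym.eq _ _).symm
  have hexp' : ∀ a : E, a = ∑ j, B a (b j) • b' j := by
    intro a
    apply b'.ext_elem
    intro i
    simp only [map_sum, map_smul, Finsupp.coe_finsetSum, Finset.sum_apply, Finsupp.smul_apply,
      Module.Basis.repr_self, smul_eq_mul]
    rw [Finset.sum_eq_single i (by intro j _ hj; simp [hj]) (by simp)]
    simp [b']
  have hcomm : ∀ x, toEnd K S V x * Ω = Ω * toEnd K S V x := by
    intro x
    have key : ∑ i, ((δ x (b i) : E) : Module.End K V) * b' i
        = - ∑ i, (b i : Module.End K V) * (δ x (b' i) : E) := by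
      have e1 : ∀ i, ((δ x (b i) : E) : Module.End K V)
          = ∑ j, B (b' j) (δ x (b i)) • (b j : Module.End K V) := by
        intro i
        conv_lhs => rw [hexp (δ x (b i))]
        simp
      have e2 : ∀ i, ((δ x (b' i) : E) : Module.End K V)
          = ∑ j, B (δ x (b' i)) (b j) • (b' j : Module.End K V) := by
        intro i
        conv_lhs => rw [hexp' (δ x (b' i))]
        simp
      simp only [e1, e2, Finset.sum_mul, Finset.mul_sum, smul_mul_assoc, mul_smul_comm]
      rw [Finset.sum_comm, ← Finset.sum_neg_distrib]
      refine Finset.sum_congr rfl fun i _ => ?_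
      rw [← Finset.sum_neg_distrib]
      refine Finset.sum_congr rfl fun j _ => ?_
      rw [hinv, neg_smul, neg_neg]
    simp only [hδ, sub_mul, mul_sub, Finset.sum_sub_distrib] at key
    simp only [Ω, Finset.mul_sum, Finset.sum_mul]
    simp only [← mul_assoc] at key ⊢
    have : ∀ p q r : Module.End K V, p - q = -(q - r) → p = r := by
      intro p q r h
      rw [neg_sub] at h
      simpa using h
    exact this _ _ _ key
  refine ⟨Ω, fun x v => (LinearMap.congr_fun (hcomm x) v).symm, fun v => ?_, fun v hv => ?_, ?_⟩
  · simp only [Ω, LinearMap.sum_apply, Module.End.mul_apply]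
    refine sum_mem fun i _ => ?_
    obtain ⟨y, hy⟩ := (b i).2
    rw [← hy, LieModule.lowerCentralSeries_succ]
    exact LieSubmodule.lie_mem_lie trivial trivial
  · simp only [Ω, LinearMap.sum_apply, Module.End.mul_apply]
    refine Finset.sum_eq_zero fun i _ => ?_
    obtain ⟨y, hy⟩ := (b' i).2
    rw [← hy]
    simp [hv]
  · have ht : LinearMap.trace K V Ω = Module.finrank K E := by
      simp only [Ω, map_sum]
      rw [Finset.sum_congr rfl (g := fun _ => (1 : K))]
      · simp
      · intro i _
        rw [← hBapp, LinearMap.BilinForm.apply_dualBasis_right hnd hsym]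
        simp
    rw [ht]
    simp only [ne_eq, Nat.cast_eq_zero]
    intro h0
    have hE : E = ⊥ := Submodule.finrank_eq_zero.mp h0
    refine h ⟨fun x v => ?_⟩
    have : toEnd K S V x ∈ E := ⟨x, rfl⟩
    rw [hE, Submodule.mem_bot] at this
    exact LinearMap.congr_fun this v

end LieAlgebra

namespace LieModule

open LieAlgebra

/-- A finite-dimensional module over a semisimple Lie algebra in characteristic zero is the direct
sum of its invariants and of the submodule generated by the action. -/
theorem isCompl_maxTrivSubmodule_lowerCentralSeries_one {K S : Type*} [Field K] [CharZero K]
    [LieRing S] [LieAlgebra K S] [FiniteDimensional K S] [HasTrivialRadical K S]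
    (V : Type*) [AddCommGroup V] [Module K V] [LieRingModule S V] [LieModule K S V]
    [FiniteDimensional K V] :
    IsCompl (maxTrivSubmodule K S V) (lowerCentralSeries K S V 1) := by
  induction hd : Module.finrank K V using Nat.strong_induction_on generalizing V with
  | _ d ih =>
  by_cases htriv : LieModule.IsTrivial S V
  · rw [(LieModule.isTrivial_iff_max_triv_eq_top K S V).mp htriv,
      (trivial_iff_lower_central_eq_bot K S V).mp htriv]
    exact isCompl_top_bot
  obtain ⟨Ω, hΩ, hΩr, hΩt, htr⟩ := exists_casimir (K := K) htriv
  obtain ⟨n, hc, hn⟩ := (Ω.eventually_isCompl_ker_pow_range_pow.and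
    (Filter.eventually_ge_atTop 1)).exists
  have hpow : ∀ (j : ℕ) (x : S) (v : V), (Ω ^ j) ⁅x, v⁆ = ⁅x, (Ω ^ j) v⁆ := by
    intro j
    induction j with
    | zero => simp
    | succ j ih => intro x v; rw [pow_succ', Module.End.mul_apply, ih, hΩ]; rfl
  let V₀ : LieSubmodule K S V :=
    { LinearMap.ker (Ω ^ n) with
      lie_mem := by
        intro x v hv
        change (Ω ^ n) _ = 0
        have : (Ω ^ n) v = 0 := hv
        rw [hpow, this, lie_zero] }
  let V₁ : LieSubmodule K S V :=
    { LinearMap.range (Ω ^ n) with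
      lie_mem := by
        rintro x - ⟨w, rfl⟩
        exact ⟨⁅x, w⁆, hpow n x w⟩ }
  have hcV : IsCompl V₀ V₁ := by
    rw [← LieSubmodule.isCompl_toSubmodule]
    exact hc
  have hlt : Module.finrank K V₀ < d := by
    rw [← hd]
    refine Submodule.finrank_lt (s := V₀.toSubmodule) ?_
    intro htop
    have h0 : Ω ^ n = 0 := LinearMap.ker_eq_top.mp htop
    exact htr (LinearMap.isNilpotent_trace_of_isNilpotent ⟨n, h0⟩).eq_zero
  have ihV := ih _ hlt V₀ rfl
  have hV₁ : V₁ ≤ lowerCentralSeries K S V 1 := by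
    rintro - ⟨w, rfl⟩
    obtain ⟨j, rfl⟩ : ∃ j, n = j + 1 := ⟨n - 1, by omega⟩
    rw [pow_succ']
    exact hΩr _
  have hmap : (lowerCentralSeries K S V₀ 1).map V₀.incl ≤ lowerCentralSeries K S V 1 :=
    map_lowerCentralSeries_le 1 _
  have hle : lowerCentralSeries K S V 1 ≤ (lowerCentralSeries K S V₀ 1).map V₀.incl ⊔ V₁ := by
    rw [lowerCentralSeries_succ, LieSubmodule.lie_le_iff]
    intro x _ v _
    obtain ⟨v₀, h₀, v₁, h₁, rfl⟩ := (LieSubmodule.mem_sup _ _ _).mp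
      (show v ∈ V₀ ⊔ V₁ by rw [hcV.sup_eq_top]; trivial)
    rw [lie_add, LieSubmodule.mem_sup]
    refine ⟨_, ?_, _, V₁.lie_mem (x := x) h₁, rfl⟩
    rw [LieSubmodule.mem_map]
    refine ⟨⁅x, ⟨v₀, h₀⟩⁆, ?_, rfl⟩
    rw [lowerCentralSeries_succ]
    exact LieSubmodule.lie_mem_lie trivial trivial
  constructor
  · rw [disjoint_iff, LieSubmodule.eq_bot_iff]
    rintro v ⟨hv, hv'⟩
    have hv : v ∈ maxTrivSubmodule K S V := hv
    rw [mem_maxTrivSubmodule] at hv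
    have hv₀ : v ∈ V₀ := by
      obtain ⟨j, rfl⟩ : ∃ j, n = j + 1 := ⟨n - 1, by omega⟩
      change (Ω ^ (j + 1)) v = 0
      rw [pow_succ, Module.End.mul_apply, hΩt v hv, map_zero]
    obtain ⟨a, ha, c, hc', hac⟩ := (LieSubmodule.mem_sup _ _ _).mp (hle hv')
    obtain ⟨a', ha', rfl⟩ := (LieSubmodule.mem_map _).mp ha
    have hc0 : c = 0 := by
      have : c ∈ V₀ ⊓ V₁ := ⟨by
        have : c = v - a' := by rw [← hac]; simp
        rw [this]
        exact sub_mem hv₀ a'.2, hc'⟩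
      rwa [hcV.inf_eq_bot, LieSubmodule.mem_bot] at this
    have hva : (a' : V) = v := by simpa [hc0] using hac
    have : a' ∈ maxTrivSubmodule K S V₀ ⊓ lowerCentralSeries K S V₀ 1 := by
      refine ⟨?_, ha'⟩
      change a' ∈ maxTrivSubmodule K S V₀
      rw [mem_maxTrivSubmodule]
      intro x
      apply Subtype.ext
      simpa [hva] using hv x
    rw [ihV.inf_eq_bot, LieSubmodule.mem_bot] at this
    simp [← hva, this]
  · rw [codisjoint_iff, eq_top_iff, ← hcV.sup_eq_top]
    refine sup_le ?_ (hV₁.trans le_sup_right)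
    intro v hv
    obtain ⟨a, ha, c, hc', hac⟩ := (LieSubmodule.mem_sup _ _ _).mp
      (show (⟨v, hv⟩ : V₀) ∈ maxTrivSubmodule K S V₀ ⊔ lowerCentralSeries K S V₀ 1 by
        rw [ihV.sup_eq_top]; trivial)
    rw [LieSubmodule.mem_sup]
    refine ⟨a, ?_, c, hmap ((LieSubmodule.mem_map _).mpr ⟨c, hc', rfl⟩), congrArg Subtype.val hac⟩
    rw [mem_maxTrivSubmodule] at ha ⊢
    intro x
    exact congrArg Subtype.val (ha x)

end LieModule

namespace LieAlgebra

lemma lowerCentralSeries_one_eq_top_of_hasTrivialRadical {K S : Type*} [Field K] [CharZero K]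
    [LieRing S] [LieAlgebra K S] [FiniteDimensional K S] [HasTrivialRadical K S] :
    lowerCentralSeries K S S 1 = ⊤ := by
  rw [LieModule.lowerCentralSeries_succ, lowerCentralSeries_zero]
  exact lie_self_eq_of_hasTrivialRadical ⊤

end LieAlgebra

namespace LieDerivation

open LieAlgebra

variable {K L : Type*} [Field K] [CharZero K] [LieRing L] [LieAlgebra K L] [FiniteDimensional K L]

lemma iterate_mem_radical_of_isSolvable (D : LieDerivation K L L) (k : ℕ) :
    ∀ I : LieIdeal K L, derivedSeriesOfIdeal K L k I = ⊥ →
      ∀ (n : ℕ), ∀ x ∈ I, D^[n] x ∈ radical K L := by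
  induction k with
  | zero =>
    intro I hI n x hx
    rw [derivedSeriesOfIdeal_zero] at hI
    rw [hI, LieSubmodule.mem_bot] at hx
    rw [hx, iterate_map_zero]
    exact zero_mem _
  | succ k ih =>
    intro I hI n
    have hI' : derivedSeriesOfIdeal K L k ⁅I, I⁆ = ⊥ := by
      rw [← hI, derivedSeriesOfIdeal_add I k 1, derivedSeriesOfIdeal_succ,
        derivedSeriesOfIdeal_zero]
    induction n using Nat.strong_induction_on with
    | _ n ihn =>
    have hlow : ∀ i < n, ∀ a ∈ I, D^[i] a ∈ radical K L := ihn
    have hlie : ∀ y : L, ∀ a ∈ I, ∃ c ∈ radical K L, ⁅y, D^[n] a⁆ = D^[n] ⁅y, a⁆ + c := by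
      intro y a ha
      refine ⟨⁅y, D^[n] a⁆ - D^[n] ⁅y, a⁆, ?_, by abel⟩
      rw [iterate_apply_lie, ← Finset.add_sum_erase _ _ (a := (0, n)) (by simp)]
      simp only [Nat.choose_zero_right, Function.iterate_zero, id_eq, one_smul, sub_add_cancel_left]
      refine neg_mem (sum_mem fun ij hij => nsmul_mem (lie_mem_right K L _ _ _ (hlow _ ?_ a ha)) _)
      rw [Finset.mem_erase, Finset.HasAntidiagonal.mem_antidiagonal] at hij
      have : ij.1 ≠ 0 := fun h => hij.1 (Prod.ext h (by simp; omega))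
      omega
    have hsq : ∀ a ∈ I, ∀ b ∈ I, ⁅D^[n] a, D^[n] b⁆ ∈ radical K L := by
      intro a ha b hb
      have h2 := ih _ hI' (n + n) ⁅a, b⁆ (LieSubmodule.lie_mem_lie ha hb)
      rw [iterate_apply_lie, ← Finset.add_sum_erase _ _ (a := (n, n)) (by simp)] at h2
      have h3 : ∑ x ∈ (Finset.HasAntidiagonal.antidiagonal (n + n)).erase (n, n),
          (n + n).choose x.1 • ⁅D^[x.1] a, D^[x.2] b⁆ ∈ radical K L := by
        refine sum_mem fun ij hij => nsmul_mem ?_ _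
        rw [Finset.mem_erase, Finset.HasAntidiagonal.mem_antidiagonal] at hij
        rcases lt_trichotomy ij.1 n with h | h | h
        · exact lie_mem_left K L _ _ _ (hlow _ h a ha)
        · exact absurd (Prod.ext h (by simp; omega)) hij.1
        · exact lie_mem_right K L _ _ _ (hlow _ (by omega) b hb)
      have h4 := (add_mem_cancel_right h3).mp h2
      rw [← Nat.cast_smul_eq_nsmul K] at h4
      have hne : (((n + n).choose n : ℕ) : K) ≠ 0 :=
        Nat.cast_ne_zero.mpr (Nat.choose_pos (by omega)).ne'
      have := SMulMemClass.smul_mem (((n + n).choose n : ℕ) : K)⁻¹ h4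
      rwa [smul_smul, inv_mul_cancel₀ hne, one_smul] at this
    let R' : LieIdeal K L :=
      { carrier := {z | ∃ r ∈ radical K L, ∃ a ∈ I, r + D^[n] a = z}
        zero_mem' := ⟨0, zero_mem _, 0, zero_mem _, by simp [iterate_map_zero]⟩
        add_mem' := by
          rintro - - ⟨r, hr, a, ha, rfl⟩ ⟨r', hr', a', ha', rfl⟩
          exact ⟨r + r', add_mem hr hr', a + a', add_mem ha ha', by rw [iterate_map_add]; abel⟩
        smul_mem' := by
          rintro c - ⟨r, hr, a, ha, rfl⟩
          refine ⟨c • r, SMulMemClass.smul_mem c hr, c • a, SMulMemClass.smul_mem c ha, ?_⟩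
          have : D^[n] (c • a) = c • D^[n] a :=
            Function.Commute.iterate_left (fun x => map_smul D c x) n a
          rw [this, smul_add]
        lie_mem := by
          rintro y - ⟨r, hr, a, ha, rfl⟩
          obtain ⟨c, hc, h⟩ := hlie y a ha
          refine ⟨⁅y, r⁆ + c, add_mem (lie_mem_right K L _ _ _ hr) hc, ⁅y, a⁆,
            lie_mem_right K L _ _ _ ha, ?_⟩
          rw [lie_add, h]
          abel }
    have hle : ⁅R', R'⁆ ≤ radical K L := by
      rw [LieSubmodule.lie_le_iff]
      rintro - ⟨r, hr, a, ha, rfl⟩ - ⟨r', hr', a', ha', rfl⟩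
      rw [add_lie, lie_add (D^[n] a)]
      exact add_mem (lie_mem_left K L _ _ _ hr) (add_mem (lie_mem_right K L _ _ _ hr') (hsq a ha a' ha'))
    obtain ⟨j, hj⟩ := IsSolvable.solvable K (radical K L)
    rw [LieIdeal.derivedSeries_eq_bot_iff] at hj
    have hsolv : IsSolvable R' := by
      refine IsSolvable.mk (R := K) (k := j + 1) ((LieIdeal.derivedSeries_eq_bot_iff R' (j + 1)).mpr ?_)
      rw [derivedSeriesOfIdeal_add, derivedSeriesOfIdeal_succ, derivedSeriesOfIdeal_zero,
        ← le_bot_iff, ← hj]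
      exact derivedSeriesOfIdeal_mono hle j
    have hR := (LieIdeal.solvable_iff_le_radical K L R').mp hsolv
    exact fun x hx => hR ⟨0, zero_mem _, x, hx, by simp⟩

/-- In characteristic zero, derivations preserve the radical. -/
theorem apply_mem_radical (D : LieDerivation K L L) {x : L} (hx : x ∈ radical K L) :
    D x ∈ radical K L := by
  obtain ⟨j, hj⟩ := IsSolvable.solvable K (radical K L)
  rw [LieIdeal.derivedSeries_eq_bot_iff] at hj
  exact D.iterate_mem_radical_of_isSolvable j _ hj 1 x hx

end LieDerivation

namespace LieModule

variable {K g M : Type*} [CommRing K] [LieRing g] [LieAlgebra K g] [AddCommGroup M] [Module K M]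
  [LieRingModule g M] [LieModule K g M]

lemma lie_mem_lowerCentralSeries_add (s : ℕ) : ∀ (t : ℕ) {x : g} {y : M},
    x ∈ lowerCentralSeries K g g s → y ∈ lowerCentralSeries K g M t →
      ⁅x, y⁆ ∈ lowerCentralSeries K g M (s + t + 1) := by
  induction s with
  | zero =>
    intro t x y _ hy
    rw [zero_add, lowerCentralSeries_succ]
    exact LieSubmodule.lie_mem_lie trivial hy
  | succ s ih =>
    intro t x y hx hy
    rw [lowerCentralSeries_succ, ← LieSubmodule.mem_toSubmodule,
      LieSubmodule.lieIdeal_oper_eq_linear_span'] at hx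
    induction hx using Submodule.span_induction with
    | mem x hx =>
      obtain ⟨a, -, b, hb, rfl⟩ := hx
      rw [lie_lie]
      refine sub_mem ?_ ?_
      · have h := ih t hb hy
        rw [show s + 1 + t + 1 = (s + t + 1) + 1 by ring, lowerCentralSeries_succ]
        exact LieSubmodule.lie_mem_lie trivial h
      · have h : ⁅a, y⁆ ∈ lowerCentralSeries K g M (t + 1) := by
          rw [lowerCentralSeries_succ]
          exact LieSubmodule.lie_mem_lie trivial hy
        rw [show s + 1 + t + 1 = s + (t + 1) + 1 by ring]
        exact ih (t + 1) hb h
    | zero => simp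
    | add x y _ _ hx hy => rw [add_lie]; exact add_mem hx hy
    | smul c x _ hx => rw [smul_lie]; exact SMulMemClass.smul_mem c hx

/-- To check a property on `[⊤, N]`, it suffices to check it on brackets. -/
lemma lowerCentralSeries_succ_induction {n : ℕ} {N : Submodule K M}
    (h : ∀ (x : g), ∀ y ∈ lowerCentralSeries K g M n, ⁅x, y⁆ ∈ N) {z : M}
    (hz : z ∈ lowerCentralSeries K g M (n + 1)) : z ∈ N := by
  rw [lowerCentralSeries_succ, ← LieSubmodule.mem_toSubmodule,
    LieSubmodule.lieIdeal_oper_eq_linear_span'] at hz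
  refine Submodule.span_le.mpr ?_ hz
  rintro - ⟨a, -, b, hb, rfl⟩
  exact h a b hb

end LieModule

lemma mem_lowerCentralLimit {K g : Type*} [Field K] [LieRing g] [LieAlgebra K g] {x : g} :
    x ∈ lowerCentralLimit K g ↔ ∀ p, x ∈ lowerCentralSeries K g g p := by
  simp [lowerCentralLimit, LieSubmodule.mem_iInf]

/-- An embedding of `g` onto a subinvariant subalgebra of `L` with trivial centralizer, where `L` is
a `g`-module through the embedding. -/
structure IsSubinvariantEmbedding {K g L : Type*} [Field K] [LieRing g] [LieAlgebra K g]
    [LieRing L] [LieAlgebra K L] [LieRingModule g L] [LieModule K g L] (ι : g →ₗ⁅K⁆ L) : Prop where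
  injective : Function.Injective ι
  lie_apply : ∀ (x : g) (y : L), ⁅ι x, y⁆ = ⁅x, y⁆
  exists_lcs_le : ∃ r, ∀ y ∈ lowerCentralSeries K g L r, ∃ x, ι x = y
  eq_zero : ∀ y : L, (∀ x : g, ⁅x, y⁆ = 0) → y = 0

namespace IsSubinvariantEmbedding

variable {K g L : Type*} [Field K] [LieRing g] [LieAlgebra K g]
    [LieRing L] [LieAlgebra K L] [LieRingModule g L] [LieModule K g L] {ι : g →ₗ⁅K⁆ L}
    (h : IsSubinvariantEmbedding ι)

include h

lemma map_lie (x y : g) : ι ⁅x, y⁆ = ⁅x, ι y⁆ := by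
  rw [LieHom.map_lie, h.lie_apply]

lemma exists_mem_lowerCentralSeries : ∃ r, ∀ t, ∀ y ∈ lowerCentralSeries K g L (r + t),
    ∃ x ∈ lowerCentralSeries K g g t, ι x = y := by
  obtain ⟨r, hr⟩ := h.exists_lcs_le
  refine ⟨r, fun t => ?_⟩
  induction t with
  | zero => intro y hy; obtain ⟨x, hx⟩ := hr y hy; exact ⟨x, trivial, hx⟩
  | succ t ih =>
    intro y hy
    let N : Submodule K L := (lowerCentralSeries K g g (t + 1)).toSubmodule.map (ι : g →ₗ[K] L)
    suffices y ∈ N from this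
    refine lowerCentralSeries_succ_induction (n := r + t) ?_ hy
    intro x z hz
    obtain ⟨w, hw, rfl⟩ := ih z hz
    refine ⟨⁅x, w⁆, ?_, h.map_lie x w⟩
    rw [lowerCentralSeries_succ]
    exact LieSubmodule.lie_mem_lie trivial hw

lemma exists_mem_lowerCentralLimit {y : L} (hy : ∀ t, y ∈ lowerCentralSeries K g L t) :
    ∃ x ∈ lowerCentralLimit K g, ι x = y := by
  obtain ⟨r, hr⟩ := h.exists_mem_lowerCentralSeries
  obtain ⟨x, -, rfl⟩ := hr 0 y (hy _)
  refine ⟨x, mem_lowerCentralLimit.mpr fun p => ?_, rfl⟩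
  obtain ⟨x', hx', hxx⟩ := hr p (ι x) (hy _)
  rwa [← h.injective hxx]

/-- The image of `C^∞(g)` is an ideal of `L`. -/
lemma exists_lie_eq {x : g} (hx : x ∈ lowerCentralLimit K g) (y : L) :
    ∃ z ∈ lowerCentralLimit K g, ι z = ⁅y, ι x⁆ := by
  refine h.exists_mem_lowerCentralLimit fun t => ?_
  rw [← lie_skew, h.lie_apply]
  refine neg_mem (antitone_lowerCentralSeries K g L (by omega : t ≤ t + 0 + 1)
    (lie_mem_lowerCentralSeries_add t 0 (mem_lowerCentralLimit.mp hx t) ?_))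
  simp

/-- The action of `L` on `C^∞(g)` by derivations. -/
lemma exists_linearMap_derivation : ∃ φ : L →ₗ[K]
    LieDerivation K (lowerCentralLimit K g) (lowerCentralLimit K g),
    ∀ (y : L) (x : lowerCentralLimit K g), ι (φ y x : g) = ⁅y, ι x⁆ := by
  have hex : ∀ (y : L) (x : lowerCentralLimit K g), ∃ z : lowerCentralLimit K g,
      ι z = ⁅y, ι x⁆ := fun y x => by
    obtain ⟨z, hz, hzx⟩ := h.exists_lie_eq x.2 y
    exact ⟨⟨z, hz⟩, hzx⟩
  choose f hf using hex
  have hinj : ∀ a b : lowerCentralLimit K g, ι (a : g) = ι (b : g) → a = b :=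
    fun a b hab => Subtype.ext (h.injective hab)
  refine ⟨{ toFun := fun y =>
              { toFun := f y
                map_add' := fun a b => hinj _ _ (by simp [hf])
                map_smul' := fun c a => hinj _ _ (by simp [hf])
                leibniz' := fun a b => hinj _ _ ?_ }
            map_add' := fun y z => ?_
            map_smul' := fun c y => ?_ }, hf⟩
  · simp only [LinearMap.coe_mk, AddHom.coe_mk, AddSubgroupClass.coe_sub, LieSubmodule.coe_bracket,
      LieIdeal.coe_bracket_of_module, LieHom.map_lie, map_sub, hf, leibniz_lie y]
    rw [← lie_skew (ι b), sub_neg_eq_add, add_comm]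
  · ext a
    exact congrArg Subtype.val (hinj _ (f y a + f z a) (by simp [hf]))
  · ext a
    exact congrArg Subtype.val (hinj _ (c • f y a) (by simp [hf]))

variable [FiniteDimensional K L]

attribute [local instance] LieRing.ofAssociativeRing

/-- The centralizer of `C^∞(g)` in `L` is contained in `C^∞(g)`. -/
lemma exists_eq_of_lie_eq_zero {y : L} (hy : ∀ x ∈ lowerCentralLimit K g, ⁅x, y⁆ = 0) :
    ∃ x ∈ lowerCentralLimit K g, ι x = y := by
  have hfin : FiniteDimensional K g :=
    FiniteDimensional.of_injective (ι : g →ₗ[K] L) h.injective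
  let Z : LieSubmodule K g L :=
    { carrier := {y | ∀ x ∈ lowerCentralLimit K g, ⁅x, y⁆ = 0}
      zero_mem' := by simp
      add_mem' := fun {a b} ha hb x hx => by rw [lie_add, ha x hx, hb x hx, add_zero]
      smul_mem' := fun c a ha x hx => by rw [lie_smul, ha x hx, smul_zero]
      lie_mem := fun {a b} hb x hx => by
        have hxa : ⁅x, a⁆ ∈ lowerCentralLimit K g := lie_mem_left K g _ _ _ hx
        rw [leibniz_lie, hb _ hxa, hb x hx, lie_zero, add_zero] }
  have hyZ : y ∈ Z := hy
  obtain ⟨p, hp⟩ : ∃ p, lowerCentralLimit K g = lowerCentralSeries K g g p := by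
    obtain ⟨p, hp⟩ := Filter.eventually_atTop.mp (eventually_iInf_lowerCentralSeries_eq K g g)
    exact ⟨p, hp p le_rfl⟩
  let R := (toEnd K g Z).range
  let π : g →ₗ⁅K⁆ R := (toEnd K g Z).rangeRestrict
  have hπ : Function.Surjective π := LieHom.surjective_rangeRestrict _
  have hnil : LieRing.IsNilpotent R := by
    refine (LieModule.isNilpotent_iff K R R).mpr ⟨p, ?_⟩
    rw [← LieIdeal.lowerCentralSeries_map_eq p hπ, LieIdeal.map_eq_bot_iff, ← hp]
    intro x hx
    rw [LieHom.mem_ker]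
    apply Subtype.ext
    ext z
    exact z.2 x hx
  have hW : genWeightSpace Z (0 : R → K) = ⊥ := by
    by_contra hne
    have hnt : Nontrivial (genWeightSpace Z (0 : R → K)) :=
      (LieSubmodule.nontrivial_iff_ne_bot K R Z).mpr hne
    have hnt' := nontrivial_max_triv_of_isNilpotent K R (genWeightSpace Z (0 : R → K))
    obtain ⟨⟨w, hw⟩, hw0⟩ := exists_ne (0 : maxTrivSubmodule K R (genWeightSpace Z (0 : R → K)))
    rw [mem_maxTrivSubmodule] at hw
    apply hw0
    have h0 : ((w : Z) : L) = 0 := h.eq_zero _ fun x =>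
      congrArg (fun v : genWeightSpace Z (0 : R → K) => ((v : Z) : L)) (hw (π x))
    exact Subtype.ext (Subtype.ext (Subtype.ext h0))
  have hF := isCompl_genWeightSpace_zero_posFittingComp K R Z
  rw [hW] at hF
  have htop : posFittingComp K R Z = ⊤ := by simpa using hF.sup_eq_top
  refine h.exists_mem_lowerCentralLimit fun t => ?_
  have h1 : (⟨y, hyZ⟩ : Z) ∈ lowerCentralSeries K R Z t := by
    have := posFittingComp_le_iInf_lowerCentralSeries K R Z
    rw [htop] at this
    exact (LieSubmodule.mem_iInf _).mp (this trivial) t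
  rw [← LieSubmodule.mem_toSubmodule, coe_lcs_range_toEnd_eq] at h1
  exact map_lowerCentralSeries_le t Z.incl ((LieSubmodule.mem_map _).mpr ⟨_, h1, rfl⟩)

/-- Schenkman's bound. -/
theorem finrank_le : Module.finrank K L ≤
    Module.finrank K (LieDerivation K (lowerCentralLimit K g) (lowerCentralLimit K g)) +
      Module.finrank K (LieAlgebra.center K (lowerCentralLimit K g)) := by
  have hfin : FiniteDimensional K g :=
    FiniteDimensional.of_injective (ι : g →ₗ[K] L) h.injective
  obtain ⟨φ, hφ⟩ := h.exists_linearMap_derivation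
  rw [← LinearMap.finrank_range_add_finrank_ker φ]
  refine add_le_add (Submodule.finrank_le _) ?_
  let ψ : LieAlgebra.center K (lowerCentralLimit K g) →ₗ[K] L :=
    (ι : g →ₗ[K] L) ∘ₗ (lowerCentralLimit K g).toSubmodule.subtype ∘ₗ
      (LieAlgebra.center K (lowerCentralLimit K g)).toSubmodule.subtype
  refine (Submodule.finrank_mono (t := LinearMap.range ψ) ?_).trans (LinearMap.finrank_range_le ψ)
  intro y hy
  have hy0 : ∀ x ∈ lowerCentralLimit K g, ⁅x, y⁆ = 0 := fun x hx => by
    rw [← h.lie_apply, ← lie_skew, ← hφ y ⟨x, hx⟩, LinearMap.mem_ker.mp hy]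
    simp
  obtain ⟨x, hx, rfl⟩ := h.exists_eq_of_lie_eq_zero hy0
  refine ⟨⟨⟨x, hx⟩, ?_⟩, rfl⟩
  rw [mem_maxTrivSubmodule]
  intro z
  apply Subtype.ext
  apply h.injective
  change ι ⁅(z : g), x⁆ = ι 0
  rw [h.map_lie, hy0 z z.2, map_zero]

end IsSubinvariantEmbedding

/-- A homomorphism that embeds `g` onto a subinvariant subalgebra with trivial centralizer. -/
def IsSubinvariantHom {K g L : Type*} [Field K] [LieRing g] [LieAlgebra K g]
    [LieRing L] [LieAlgebra K L] (ι : g →ₗ⁅K⁆ L) : Prop :=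
  letI := LieRingModule.compLieHom L ι
  letI := LieModule.compLieHom L ι
  IsSubinvariantEmbedding ι

namespace IsSubinvariantHom

variable {K g L : Type*} [Field K] [LieRing g] [LieAlgebra K g] [LieRing L] [LieAlgebra K L]

lemma id (hZ : LieAlgebra.center K g = ⊥) : IsSubinvariantHom (LieHom.id : g →ₗ⁅K⁆ g) := by
  unfold IsSubinvariantHom
  refine @IsSubinvariantEmbedding.mk K g g _ _ _ _ _ (LieRingModule.compLieHom g LieHom.id)
    (LieModule.compLieHom g LieHom.id) _ Function.injective_id (fun _ _ => rfl)
    ⟨0, fun y _ => ⟨y, rfl⟩⟩ fun y hy => ?_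
  have : y ∈ LieAlgebra.center K g := (mem_maxTrivSubmodule K g g y).mpr hy
  rwa [hZ, LieSubmodule.mem_bot] at this

variable {ι : g →ₗ⁅K⁆ L}

lemma center_eq_bot (h : IsSubinvariantHom ι) : LieAlgebra.center K L = ⊥ := by
  let _ := LieRingModule.compLieHom L ι
  let _ := LieModule.compLieHom L ι
  rw [LieSubmodule.eq_bot_iff]
  intro y hy
  rw [mem_maxTrivSubmodule] at hy
  exact IsSubinvariantEmbedding.eq_zero h y fun x => hy (ι x)

lemma ad_comp (h : IsSubinvariantHom ι) : IsSubinvariantHom ((LieDerivation.ad K L).comp ι) := by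
  have hc := h.center_eq_bot
  let _ := LieRingModule.compLieHom L ι
  let _ := LieModule.compLieHom L ι
  replace h : IsSubinvariantEmbedding ι := h
  have had := LieDerivation.injective_ad_of_center_eq_bot hc
  let _ := LieRingModule.compLieHom (LieDerivation K L L) ((LieDerivation.ad K L).comp ι)
  let _ := LieModule.compLieHom (LieDerivation K L L) ((LieDerivation.ad K L).comp ι)
  have hlie : ∀ (x : g) (D : LieDerivation K L L),
      ⁅x, D⁆ = LieDerivation.ad K L (-(D (ι x))) := fun x D => by
    change ⁅LieDerivation.ad K L (ι x), D⁆ = _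
    rw [LieDerivation.lie_ad, map_neg, LieDerivation.ad_apply_lieDerivation, neg_neg]
  obtain ⟨r, hr⟩ := h.exists_lcs_le
  have hlcs : ∀ t, ∀ D ∈ lowerCentralSeries K g (LieDerivation K L L) (t + 1),
      ∃ y ∈ lowerCentralSeries K g L t, LieDerivation.ad K L y = D := by
    intro t
    induction t with
    | zero =>
      intro D hD
      refine lowerCentralSeries_succ_induction (n := 0) (N := ((⊤ : Submodule K L).map
        (LieDerivation.ad K L : L →ₗ[K] LieDerivation K L L))) ?_ hD
      intro x D _
      exact ⟨_, trivial, (hlie x D).symm⟩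
    | succ t ih =>
      intro D hD
      refine lowerCentralSeries_succ_induction (n := t + 1)
        (N := ((lowerCentralSeries K g L (t + 1)).toSubmodule.map
        (LieDerivation.ad K L : L →ₗ[K] LieDerivation K L L))) ?_ hD
      intro x D hD
      obtain ⟨y, hy, rfl⟩ := ih D hD
      refine ⟨⁅x, y⁆, ?_, LieHom.map_lie _ _ _⟩
      change ⁅x, y⁆ ∈ lowerCentralSeries K g L (t + 1)
      rw [LieModule.lowerCentralSeries_succ]
      exact LieSubmodule.lie_mem_lie trivial hy
  refine ⟨had.comp h.injective, fun _ _ => rfl, ⟨r + 1, fun D hD => ?_⟩, fun c hc => ?_⟩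
  · obtain ⟨y, hy, rfl⟩ := hlcs r D hD
    obtain ⟨x, rfl⟩ := hr y hy
    exact ⟨x, rfl⟩
  · have hcι : ∀ x : g, c (ι x) = 0 := fun x => by
      have := hc x
      rw [hlie, ← map_zero (LieDerivation.ad K L)] at this
      exact neg_eq_zero.mp (had this)
    have hdown : ∀ i, (∀ y ∈ lowerCentralSeries K g L i, c y = 0) → ∀ y, c y = 0 := by
      intro i
      induction i with
      | zero => exact fun h0 y => h0 y trivial
      | succ i ih =>
        intro hi
        refine ih fun y hy => h.eq_zero _ fun x => ?_
        have h1 : c ⁅ι x, y⁆ = 0 := by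
          rw [h.lie_apply]
          refine hi _ ?_
          rw [LieModule.lowerCentralSeries_succ]
          exact LieSubmodule.lie_mem_lie trivial hy
        rw [LieDerivation.apply_lie_eq_add, hcι, zero_lie, add_zero] at h1
        rw [← h.lie_apply, h1]
    ext y
    refine hdown r (fun y hy => ?_) y
    obtain ⟨x, rfl⟩ := hr y hy
    exact hcι x

end IsSubinvariantHom

section Tower

variable {K : Type u} [Field K] {g : Type v} [LieRing g] [LieAlgebra K g]

lemma exists_isSubinvariantHom_derivationTower (hZ : LieAlgebra.center K g = ⊥) (n : ℕ) :
    ∃ ι : g →ₗ⁅K⁆ (derivationTower K g n).carrier, IsSubinvariantHom ι := by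
  induction n with
  | zero => exact ⟨_, IsSubinvariantHom.id hZ⟩
  | succ n ih =>
    obtain ⟨ι, h⟩ := ih
    exact ⟨_, h.ad_comp⟩

lemma finiteDimensional_derivationTower [FiniteDimensional K g] (n : ℕ) :
    FiniteDimensional K (derivationTower K g n).carrier := by
  induction n with
  | zero => assumption
  | succ n ih =>
    exact FiniteDimensional.of_injective _
      (LieDerivation.toLinearMapLieHom_injective K (derivationTower K g n).carrier)

theorem finrank_derivationTower_le [FiniteDimensional K g] (hZ : LieAlgebra.center K g = ⊥) (n : ℕ) :
    Module.finrank K (derivationTower K g n).carrier ≤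
      Module.finrank K (LieDerivation K (lowerCentralLimit K g) (lowerCentralLimit K g)) +
        Module.finrank K (LieAlgebra.center K (lowerCentralLimit K g)) := by
  obtain ⟨ι, h⟩ := exists_isSubinvariantHom_derivationTower hZ n
  have := finiteDimensional_derivationTower (K := K) (g := g) n
  let _ := LieRingModule.compLieHom (derivationTower K g n).carrier ι
  let _ := LieModule.compLieHom (derivationTower K g n).carrier ι
  exact IsSubinvariantEmbedding.finrank_le h

lemma injective_ad_derivationTower (hZ : LieAlgebra.center K g = ⊥) (n : ℕ) :
    Function.Injective (LieDerivation.ad K (derivationTower K g n).carrier) := by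
  obtain ⟨ι, h⟩ := exists_isSubinvariantHom_derivationTower hZ n
  exact LieDerivation.injective_ad_of_center_eq_bot h.center_eq_bot

/-- Schenkman's derivation tower theorem. -/
theorem exists_derivationTowerTerminatesAt [FiniteDimensional K g]
    (hZ : LieAlgebra.center K g = ⊥) :
    ∃ N, DerivationTowerTerminatesAt K g N := by
  let d : ℕ → ℕ := fun n => Module.finrank K (derivationTower K g n).carrier
  have hinj := injective_ad_derivationTower (K := K) hZ
  have hfin := finiteDimensional_derivationTower (K := K) (g := g)
  let f : ∀ n, (derivationTower K g n).carrier →ₗ[K] (derivationTower K g (n + 1)).carrier :=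
    fun n => (LieDerivation.ad K (derivationTower K g n).carrier).toLinearMap
  have hf : ∀ n, Function.Injective (f n) := hinj
  have hmono : Monotone d := monotone_nat_of_le_succ fun n =>
    have := hfin (n + 1)
    LinearMap.finrank_le_finrank_of_injective (hf n)
  obtain ⟨N, hN⟩ : ∃ N, ∀ n, d n ≤ d N := by
    have hb : BddAbove (Set.range d) :=
      ⟨_, by rintro - ⟨n, rfl⟩; exact finrank_derivationTower_le hZ n⟩
    obtain ⟨N, hN⟩ := Nat.sSup_mem (Set.range_nonempty d) hb
    exact ⟨N, fun n => hN ▸ le_csSup hb ⟨n, rfl⟩⟩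
  refine ⟨N, fun n hn => ⟨hinj n, ?_⟩⟩
  have := hfin n
  have := hfin (n + 1)
  have heq : d n = d (n + 1) := le_antisymm (hmono n.le_succ) ((hN _).trans (hmono hn))
  exact (LinearMap.injective_iff_surjective_of_finrank_eq_finrank heq).mp (hf n)

end Tower

namespace LieModule

section CommutingActions

variable (K S N V : Type*) [Field K] [LieRing S] [LieAlgebra K S] [LieRing N] [LieAlgebra K N]
  [LieRing.IsNilpotent N] [AddCommGroup V] [Module K V] [LieRingModule S V] [LieModule K S V]
  [LieRingModule N V] [LieModule K N V]

/-- The elements that are invariant under `S` and on which `N` acts nilpotently. -/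
def nullPart : Submodule K V :=
  (maxTrivSubmodule K S V).toSubmodule ⊓ (genWeightSpace V (0 : N → K)).toSubmodule

/-- The sum of `[S, V]` and the positive Fitting component of `N`. -/
def movedPart : Submodule K V :=
  (lowerCentralSeries K S V 1).toSubmodule ⊔ (posFittingComp K N V).toSubmodule

variable {K S N V}

lemma mem_nullPart {v : V} : v ∈ nullPart K S N V ↔
    (∀ a : S, ⁅a, v⁆ = 0) ∧ v ∈ genWeightSpace V (0 : N → K) := by
  rw [nullPart, Submodule.mem_inf, LieSubmodule.mem_toSubmodule, LieSubmodule.mem_toSubmodule,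
    mem_maxTrivSubmodule]

lemma isCompl_nullPart_movedPart [CharZero K] [FiniteDimensional K S]
    [LieAlgebra.HasTrivialRadical K S] [FiniteDimensional K V]
    (hcomm : ∀ (a : S) (b : N) (v : V), ⁅a, ⁅b, v⁆⁆ = ⁅b, ⁅a, v⁆⁆) :
    IsCompl (nullPart K S N V) (movedPart K S N V) := by
  let f : S → (V →ₗ⁅K,N⁆ V) := fun a => { toEnd K S V a with map_lie' := fun {b v} => hcomm a b v }
  let V₀ : LieSubmodule K S V :=
    { (genWeightSpace V (0 : N → K)).toSubmodule with
      lie_mem := fun {a v} hv =>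
        map_genWeightSpace_le (f a) ((LieSubmodule.mem_map _).mpr ⟨v, hv, rfl⟩) }
  let P : LieSubmodule K S V :=
    { (posFittingComp K N V).toSubmodule with
      lie_mem := fun {a v} hv =>
        map_posFittingComp_le (f a) ((LieSubmodule.mem_map _).mpr ⟨v, hv, rfl⟩) }
  have hc : IsCompl V₀ P := by
    have hF := isCompl_genWeightSpace_zero_posFittingComp K N V
    rw [← LieSubmodule.isCompl_toSubmodule] at hF ⊢
    exact hF
  have hV₀ := isCompl_maxTrivSubmodule_lowerCentralSeries_one (K := K) (S := S) V₀
  have hmap : (lowerCentralSeries K S V₀ 1).map V₀.incl ≤ lowerCentralSeries K S V 1 :=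
    map_lowerCentralSeries_le 1 _
  have hle : lowerCentralSeries K S V 1 ≤ (lowerCentralSeries K S V₀ 1).map V₀.incl ⊔ P := by
    rw [LieModule.lowerCentralSeries_succ, LieSubmodule.lie_le_iff]
    intro x _ v _
    obtain ⟨v₀, h₀, v₁, h₁, rfl⟩ := (LieSubmodule.mem_sup _ _ _).mp
      (show v ∈ V₀ ⊔ P by rw [hc.sup_eq_top]; trivial)
    rw [lie_add, LieSubmodule.mem_sup]
    refine ⟨_, ?_, _, P.lie_mem (x := x) h₁, rfl⟩
    rw [LieSubmodule.mem_map]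
    refine ⟨⁅x, ⟨v₀, h₀⟩⁆, ?_, rfl⟩
    rw [LieModule.lowerCentralSeries_succ]
    exact LieSubmodule.lie_mem_lie trivial trivial
  constructor
  · rw [Submodule.disjoint_def]
    intro v hv hv'
    obtain ⟨hv, hv₀⟩ := mem_nullPart.mp hv
    have hv₁ : v ∈ (lowerCentralSeries K S V₀ 1).map V₀.incl ⊔ P :=
      (sup_le hle le_sup_right : lowerCentralSeries K S V 1 ⊔ P ≤ _)
        (by rwa [← LieSubmodule.mem_toSubmodule, LieSubmodule.sup_toSubmodule])
    obtain ⟨a, ha, c, hc', hac⟩ := (LieSubmodule.mem_sup _ _ _).mp hv₁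
    obtain ⟨a', ha', rfl⟩ := (LieSubmodule.mem_map _).mp ha
    have hc0 : c = 0 := by
      have : c ∈ V₀ ⊓ P := ⟨by
        have : c = v - a' := by rw [← hac]; simp
        rw [this]
        exact sub_mem hv₀ a'.2, hc'⟩
      rwa [hc.inf_eq_bot, LieSubmodule.mem_bot] at this
    have hva : (a' : V) = v := by simpa [hc0] using hac
    have : a' ∈ maxTrivSubmodule K S V₀ ⊓ lowerCentralSeries K S V₀ 1 := by
      refine ⟨?_, ha'⟩
      change a' ∈ maxTrivSubmodule K S V₀
      rw [mem_maxTrivSubmodule]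
      intro x
      apply Subtype.ext
      simpa [hva] using hv x
    rw [hV₀.inf_eq_bot, LieSubmodule.mem_bot] at this
    simp [← hva, this]
  · rw [codisjoint_iff, eq_top_iff]
    intro v _
    obtain ⟨v₀, h₀, v₁, h₁, rfl⟩ := (LieSubmodule.mem_sup _ _ _).mp
      (show v ∈ V₀ ⊔ P by rw [hc.sup_eq_top]; trivial)
    refine add_mem ?_ (Submodule.mem_sup_right (Submodule.mem_sup_right h₁))
    obtain ⟨a, ha, c, hc', hac⟩ := (LieSubmodule.mem_sup _ _ _).mp
      (show (⟨v₀, h₀⟩ : V₀) ∈ maxTrivSubmodule K S V₀ ⊔ lowerCentralSeries K S V₀ 1 by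
        rw [hV₀.sup_eq_top]; trivial)
    have hac' : (a : V) + c = v₀ := congrArg Subtype.val hac
    rw [← hac']
    refine add_mem (Submodule.mem_sup_left (mem_nullPart.mpr ⟨fun x => ?_, a.2⟩))
      (Submodule.mem_sup_right (Submodule.mem_sup_left
        (hmap ((LieSubmodule.mem_map _).mpr ⟨c, hc', rfl⟩))))
    exact congrArg Subtype.val ((mem_maxTrivSubmodule K S V₀ a).mp ha x)

end CommutingActions

end LieModule

namespace Module.End

variable {K V W : Type*} [Field K] [AddCommGroup V] [Module K V] [AddCommGroup W] [Module K W]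

/-- `x = u + v` is the Jordan decomposition of `x`. -/
structure IsJordanDecomposition (x u v : Module.End K V) : Prop where
  isSemisimple : u.IsSemisimple
  isNilpotent : IsNilpotent v
  commute : Commute u v
  eq_add : x = u + v

namespace IsJordanDecomposition

variable {x u v : Module.End K V}

lemma commute_left (h : IsJordanDecomposition x u v) : Commute x u := by
  rw [h.eq_add]
  exact (Commute.refl u).add_left h.commute.symm

lemma commute_right (h : IsJordanDecomposition x u v) : Commute x v := by
  rw [h.eq_add]
  exact h.commute.add_left (Commute.refl v)

lemma pow_apply_eq_zero (h : IsJordanDecomposition x u v) {y : V} (hy : u y = 0) :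
    ∃ n, (x ^ n) y = 0 := by
  have hpow : ∀ n, (x ^ n) y = (v ^ n) y := by
    intro n
    induction n with
    | zero => rfl
    | succ n ih =>
      have hc : x * v ^ n = v ^ n * x := h.commute_right.pow_right n
      rw [pow_succ', Module.End.mul_apply, ih, ← Module.End.mul_apply, hc, pow_succ,
        Module.End.mul_apply, Module.End.mul_apply, h.eq_add, LinearMap.add_apply, hy, zero_add]
  obtain ⟨n, hn⟩ := h.isNilpotent
  exact ⟨n, by rw [hpow, hn]; rfl⟩

lemma apply_eq_zero [FiniteDimensional K V] (h : IsJordanDecomposition x u v) (n : ℕ) :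
    ∀ {y : V}, (x ^ n) y = 0 → u y = 0 := by
  induction n with
  | zero => intro y hy; have : y = 0 := hy; rw [this, map_zero]
  | succ n ih =>
    intro y hy
    have h1 : x (u y) = 0 := by
      have := ih (y := x y) (by rwa [← Module.End.mul_apply, ← pow_succ])
      rwa [← Module.End.mul_apply, h.commute_left.eq]
    have h2 : ∀ j, (u ^ j) (u y) = ((-v) ^ j) (u y) := by
      intro j
      induction j with
      | zero => rfl
      | succ j ihj =>
        have hc : u * (-v) ^ j = (-v) ^ j * u := (h.commute.neg_right).pow_right j
        have h3 : u (u y) = (-v) (u y) := by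
          rw [h.eq_add, LinearMap.add_apply] at h1
          rw [LinearMap.neg_apply]
          exact eq_neg_of_add_eq_zero_left h1
        rw [pow_succ', Module.End.mul_apply, ihj, ← Module.End.mul_apply, hc, pow_succ,
          Module.End.mul_apply, Module.End.mul_apply, h3]
    obtain ⟨d, hd⟩ := h.isNilpotent.neg
    have h4 : (u ^ (d + 1)) y = 0 := by
      rw [pow_succ, Module.End.mul_apply, h2, hd]
      rfl
    have h5 : y ∈ u.maxGenEigenspace 0 := by
      rw [Module.End.mem_maxGenEigenspace]
      exact ⟨d + 1, by simpa using h4⟩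
    rw [h.isSemisimple.isFinitelySemisimple.maxGenEigenspace_eq_eigenspace,
      Module.End.mem_eigenspace_iff, zero_smul] at h5
    exact h5

lemma exists_apply_eq (h : IsJordanDecomposition x u v) {z : V} (hz : ∀ n, ∃ w, (x ^ n) w = z) :
    ∃ w, u w = z := by
  obtain ⟨d, hd⟩ := h.isNilpotent
  obtain ⟨q, hq⟩ := h.commute_right.sub_dvd_pow_sub_pow d
  rw [hd, sub_zero, h.eq_add, add_sub_cancel_right] at hq
  obtain ⟨w, rfl⟩ := hz d
  exact ⟨q w, by rw [← Module.End.mul_apply, ← hq, h.eq_add]⟩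

lemma exists_pow_apply_eq [FiniteDimensional K V] (h : IsJordanDecomposition x u v) (w : V)
    (n : ℕ) : ∃ w', (x ^ n) w' = u w := by
  obtain ⟨m, hc, hm⟩ := (x.eventually_isCompl_ker_pow_range_pow.and
    (Filter.eventually_ge_atTop n)).exists
  obtain ⟨w₀, h₀, -, ⟨w₁, rfl⟩, rfl⟩ := Submodule.mem_sup.mp
    (show w ∈ LinearMap.ker (x ^ m) ⊔ LinearMap.range (x ^ m) by rw [hc.sup_eq_top]; trivial)
  obtain ⟨j, rfl⟩ := Nat.exists_eq_add_of_le hm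
  refine ⟨(x ^ j) (u w₁), ?_⟩
  have hx : x ^ (n + j) * u = u * x ^ (n + j) := h.commute_left.pow_left (n + j)
  rw [map_add, h.apply_eq_zero (n + j) h₀, zero_add, ← Module.End.mul_apply, ← Module.End.mul_apply,
    ← Module.End.mul_apply, ← pow_add, hx]

variable [FiniteDimensional K V] [FiniteDimensional K W]

lemma mem_adjoin [PerfectField K] (h : IsJordanDecomposition x u v) :
    u ∈ Algebra.adjoin K {x} := by
  obtain ⟨n, -, s, hs, hn_nil, hs_ss, hx⟩ := x.exists_isNilpotent_isSemisimple
  have hc : Commute n s := by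
    have h1 : Commute x s := Algebra.commute_of_mem_adjoin_self hs
    have h2 : n = x - s := by rw [hx, add_sub_cancel_right]
    rw [h2]
    exact h1.sub_left (Commute.refl s)
  have := (isNilpotent_isSemisimple_unique h.isNilpotent h.isSemisimple hn_nil hs_ss
    h.commute.symm hc (by rw [← hx, h.eq_add, add_comm])).2
  rwa [this]

lemma mem_of_mem [PerfectField K] (h : IsJordanDecomposition x u v) {p : Submodule K V}
    (hp : ∀ y ∈ p, x y ∈ p) {y : V} (hy : y ∈ p) : u y ∈ p := by
  have hu := h.mem_adjoin
  rw [Algebra.adjoin_singleton_eq_range_aeval] at hu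
  obtain ⟨q, rfl⟩ := hu
  exact q.aeval_apply_smul_mem_of_le_comap hy _ hp

lemma commute_of_commute [PerfectField K] (h : IsJordanDecomposition x u v) {y : Module.End K V}
    (hy : Commute y x) : Commute y u :=
  Algebra.commute_of_mem_adjoin_singleton_of_commute h.mem_adjoin hy

end IsJordanDecomposition

end Module.End

namespace LinearMap

open Module.End

variable {K V W : Type*} [Field K] [AddCommGroup V] [Module K V] [AddCommGroup W] [Module K W]

lemma pow_lcomp_apply (u : Module.End K V) (n : ℕ) : ∀ f : V →ₗ[K] W,
    ((lcomp K W u : Module.End K (V →ₗ[K] W)) ^ n) f = f ∘ₗ (u ^ n) := by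
  induction n with
  | zero => intro f; rfl
  | succ n ih => intro f; rw [pow_succ, Module.End.mul_apply, ih, pow_succ']; rfl

lemma pow_compRight_apply (u : Module.End K W) (n : ℕ) : ∀ f : V →ₗ[K] W,
    ((compRight K u : Module.End K (V →ₗ[K] W)) ^ n) f = (u ^ n) ∘ₗ f := by
  induction n with
  | zero => intro f; rfl
  | succ n ih => intro f; rw [pow_succ, Module.End.mul_apply, ih, pow_succ]; rfl

lemma aeval_lcomp_apply (u : Module.End K V) (p : Polynomial K) (f : V →ₗ[K] W) :
    Polynomial.aeval (lcomp K W u : Module.End K (V →ₗ[K] W)) p f =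
      f ∘ₗ Polynomial.aeval u p := by
  induction p using Polynomial.induction_on' with
  | add p q hp hq => simp [hp, hq, LinearMap.comp_add]
  | monomial n a => ext w; simp [Polynomial.aeval_monomial, pow_lcomp_apply]

lemma aeval_compRight_apply (u : Module.End K W) (p : Polynomial K) (f : V →ₗ[K] W) :
    Polynomial.aeval (compRight K u : Module.End K (V →ₗ[K] W)) p f =
      Polynomial.aeval u p ∘ₗ f := by
  induction p using Polynomial.induction_on' with
  | add p q hp hq => simp [hp, hq, LinearMap.add_comp]
  | monomial n a => ext w; simp [Polynomial.aeval_monomial, pow_compRight_apply]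

lemma isSemisimple_lcomp [FiniteDimensional K V] {u : Module.End K V} (hu : u.IsSemisimple) :
    Module.End.IsSemisimple (lcomp K W u : Module.End K (V →ₗ[K] W)) := by
  refine isSemisimple_of_squarefree_aeval_eq_zero hu.minpoly_squarefree ?_
  ext1 f
  rw [aeval_lcomp_apply, minpoly.aeval, comp_zero, zero_apply]

lemma isSemisimple_compRight [FiniteDimensional K W] {u : Module.End K W} (hu : u.IsSemisimple) :
    Module.End.IsSemisimple (compRight K u : Module.End K (V →ₗ[K] W)) := by
  refine isSemisimple_of_squarefree_aeval_eq_zero hu.minpoly_squarefree ?_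
  ext1 f
  rw [aeval_compRight_apply, minpoly.aeval, zero_comp, zero_apply]

end LinearMap

namespace Module.End.IsJordanDecomposition

variable {K V W : Type*} [Field K] [PerfectField K] [AddCommGroup V] [Module K V]
  [AddCommGroup W] [Module K W] [FiniteDimensional K V] [FiniteDimensional K W]

/-- Linear maps that intertwine two endomorphisms intertwine their semisimple parts. -/
lemma apply_comm {x u v : Module.End K V} {x' u' v' : Module.End K W}
    (h : IsJordanDecomposition x u v) (h' : IsJordanDecomposition x' u' v') {f : V →ₗ[K] W}
    (hf : ∀ y, f (x y) = x' (f y)) (y : V) : f (u y) = u' (f y) := by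
  let P : Module.End K W → Module.End K (V →ₗ[K] W) := fun a => LinearMap.compRight K a
  let Q : Module.End K V → Module.End K (V →ₗ[K] W) := fun b => LinearMap.lcomp K W b
  have hPQ : ∀ a b, Commute (P a) (Q b) := fun a b => by ext; rfl
  have hPP : ∀ {a b}, Commute a b → Commute (P a) (P b) := fun {a b} hab => by
    ext g z
    exact LinearMap.congr_fun hab (g z)
  have hQQ : ∀ {a b}, Commute a b → Commute (Q a) (Q b) := fun {a b} hab => by
    ext g z
    exact congrArg g (LinearMap.congr_fun hab z).symm
  have hJ : IsJordanDecomposition (P x' - Q x) (P u' - Q u) (P v' - Q v) := by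
    refine ⟨?_, ?_, ?_, ?_⟩
    · exact (LinearMap.isSemisimple_compRight h'.isSemisimple).sub_of_commute (hPQ _ _)
        (LinearMap.isSemisimple_lcomp h.isSemisimple)
    · refine (hPQ _ _).isNilpotent_sub ?_ ?_
      · obtain ⟨n, hn⟩ := h'.isNilpotent
        refine ⟨n, ?_⟩
        ext1 g
        rw [LinearMap.pow_compRight_apply, hn, LinearMap.zero_comp, LinearMap.zero_apply]
      · obtain ⟨n, hn⟩ := h.isNilpotent
        refine ⟨n, ?_⟩
        ext1 g
        rw [LinearMap.pow_lcomp_apply, hn, LinearMap.comp_zero, LinearMap.zero_apply]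
    · exact ((hPP h'.commute).sub_right (hPQ _ _)).sub_left
        ((hPQ _ _).symm.sub_right (hQQ h.commute))
    · ext g z
      simp only [P, Q, h.eq_add, h'.eq_add, LinearMap.sub_apply, LinearMap.add_apply,
        LinearMap.compRight_apply, LinearMap.lcomp_apply, LinearMap.comp_apply, map_add]
      abel
  have h0 : (P u' - Q u) f = 0 := by
    refine hJ.apply_eq_zero 1 ?_
    ext z
    simp [P, Q, hf]
  have := LinearMap.congr_fun h0 y
  simp only [P, Q, LinearMap.sub_apply, LinearMap.compRight_apply, LinearMap.lcomp_apply,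
    LinearMap.comp_apply, LinearMap.zero_apply] at this
  exact (sub_eq_zero.mp this).symm

attribute [local instance] LieRing.ofAssociativeRing

/-- The semisimple part of a derivation is a derivation. -/
lemma apply_lie {L : Type*} [LieRing L] [LieAlgebra K L] [FiniteDimensional K L]
    {x u v : Module.End K L} (h : IsJordanDecomposition x u v)
    (hx : ∀ y z : L, x ⁅y, z⁆ = ⁅x y, z⁆ + ⁅y, x z⁆) (y z : L) :
    u ⁅y, z⁆ = ⁅u y, z⁆ + ⁅y, u z⁆ := by
  have hJ : IsJordanDecomposition (LieAlgebra.ad K (Module.End K L) x)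
      (LieAlgebra.ad K (Module.End K L) u) (LieAlgebra.ad K (Module.End K L) v) :=
    ⟨LieAlgebra.ad_isSemisimple_of_isSemisimple h.isSemisimple,
      LieAlgebra.ad_nilpotent_of_nilpotent (R := K) h.isNilpotent,
      LieAlgebra.commute_ad_of_commute h.commute, by rw [← map_add, h.eq_add]⟩
  have := h.apply_comm hJ (f := (LieAlgebra.ad K L : L →ₗ[K] Module.End K L)) (fun y => by
    ext z
    simp [LieRing.of_associative_ring_bracket, hx]) y
  have := LinearMap.congr_fun this z
  simp only [LieHom.coe_toLinearMap, LieAlgebra.ad_apply, LieRing.of_associative_ring_bracket,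
    LinearMap.sub_apply, Module.End.mul_apply] at this
  rw [this, sub_add_cancel]

end Module.End.IsJordanDecomposition

lemma LieSubalgebra.lowerCentralSeries_le {K g V : Type*} [CommRing K] [LieRing g] [LieAlgebra K g]
    [AddCommGroup V] [Module K V] [LieRingModule g V] [LieModule K g V] (A : LieSubalgebra K g)
    (n : ℕ) {v : V} (hv : v ∈ lowerCentralSeries K A V n) : v ∈ lowerCentralSeries K g V n := by
  induction n generalizing v with
  | zero => trivial
  | succ n ih =>
    refine lowerCentralSeries_succ_induction
      (N := (lowerCentralSeries K g V (n + 1)).toSubmodule) (fun x y hy => ?_) hv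
    change ⁅(x : g), y⁆ ∈ lowerCentralSeries K g V (n + 1)
    rw [LieModule.lowerCentralSeries_succ]
    exact LieSubmodule.lie_mem_lie trivial (ih hy)

/-- A map with the Leibniz rule maps the subalgebra generated by `m` into itself as soon as it does
so with `m`. -/
lemma exists_mem_nHat_of_leibniz {K g L : Type*} [Field K] [LieRing g] [LieAlgebra K g]
    [LieRing L] [LieAlgebra K L] (ι : g →ₗ⁅K⁆ L) {m : Submodule K g} (f : g →ₗ[K] L)
    (hf : ∀ x y, f ⁅x, y⁆ = ⁅f x, ι y⁆ + ⁅ι x, f y⁆) (hm : ∀ x ∈ m, ∃ y ∈ nHat K m, ι y = f x)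
    {x : g} (hx : x ∈ nHat K m) : ∃ y ∈ nHat K m, ι y = f x := by
  let A : LieSubalgebra K g :=
    { carrier := {x | x ∈ nHat K m ∧ ∃ y ∈ nHat K m, ι y = f x}
      zero_mem' := ⟨zero_mem _, 0, zero_mem _, by simp⟩
      add_mem' := by
        rintro a b ⟨ha, a', ha', h⟩ ⟨hb, b', hb', h'⟩
        exact ⟨add_mem ha hb, a' + b', add_mem ha' hb', by simp [h, h']⟩
      smul_mem' := by
        rintro c a ⟨ha, a', ha', h⟩
        exact ⟨SMulMemClass.smul_mem c ha, c • a', SMulMemClass.smul_mem c ha', by simp [h]⟩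
      lie_mem' := by
        rintro a b ⟨ha, a', ha', h⟩ ⟨hb, b', hb', h'⟩
        exact ⟨(nHat K m).lie_mem ha hb, ⁅a', b⁆ + ⁅a, b'⁆,
          add_mem ((nHat K m).lie_mem ha' hb) ((nHat K m).lie_mem ha hb'), by simp [h, h', hf]⟩ }
  have : nHat K m ≤ A := LieSubalgebra.lieSpan_le.mpr fun z hz =>
    ⟨LieSubalgebra.subset_lieSpan hz, hm z hz⟩
  exact (this hx).2

namespace IsGammaTriple

open LieAlgebra

variable {K : Type*} [Field K] {g : Type*} [LieRing g] [LieAlgebra K g]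
  {s k : LieSubalgebra K g} {m : Submodule K g}

section

variable (T : IsGammaTriple K s k m)
include T

lemma exists_add_eq (x : g) : ∃ a ∈ s, ∃ r ∈ radical K g, a + r = x := by
  have hx : x ∈ s.toSubmodule ⊔ (radical K g).toSubmodule := by
    rw [T.levi.sup_eq_top]; trivial
  exact Submodule.mem_sup.mp hx

lemma eq_zero_of_mem {x : g} (hx : x ∈ s) (hx' : x ∈ radical K g) : x = 0 :=
  Submodule.disjoint_def.mp T.levi.disjoint x hx hx'

lemma m_le_radical {x : g} (hx : x ∈ m) : x ∈ radical K g := by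
  have : x ∈ m ⊔ k.toSubmodule := Submodule.mem_sup_left hx
  rwa [T.sup_eq] at this

lemma exists_add_add_eq (x : g) : ∃ a ∈ s, ∃ b ∈ k, ∃ c ∈ m, a + b + c = x := by
  obtain ⟨a, ha, r, hr, rfl⟩ := T.exists_add_eq x
  have hr' : r ∈ m ⊔ k.toSubmodule := by rw [T.sup_eq]; exact hr
  obtain ⟨c, hc, b, hb, rfl⟩ := Submodule.mem_sup.mp hr'
  exact ⟨a, ha, b, hb, c, hc, by abel⟩

lemma lie_mem_m {x y : g} (hx : x ∈ s.toSubmodule ⊔ k.toSubmodule) (hy : y ∈ m) : ⁅x, y⁆ ∈ m := by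
  have : ⁅x, y⁆ ∈ Submodule.span K
    {z : g | ∃ x ∈ s.toSubmodule ⊔ k.toSubmodule, ∃ y ∈ m, ⁅x, y⁆ = z} :=
    Submodule.subset_span ⟨x, hx, y, hy, rfl⟩
  rwa [T.lie_eq] at this

lemma m_le {N : Submodule K g} (hN : ∀ x ∈ s.toSubmodule ⊔ k.toSubmodule, ∀ y ∈ m, ⁅x, y⁆ ∈ N) :
    m ≤ N := by
  rw [← T.lie_eq, Submodule.span_le]
  rintro - ⟨x, hx, y, hy, rfl⟩
  exact hN x hx y hy

lemma lie_mem_nHat {x y : g} (hx : x ∈ s.toSubmodule ⊔ k.toSubmodule) (hy : y ∈ nHat K m) :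
    ⁅x, y⁆ ∈ nHat K m := by
  obtain ⟨z, hz, h⟩ := exists_mem_nHat_of_leibniz (LieHom.id : g →ₗ⁅K⁆ g) (LieAlgebra.ad K g x : g →ₗ[K] g)
    (fun a b => leibniz_lie x a b)
    (fun a ha => ⟨_, LieSubalgebra.subset_lieSpan (T.lie_mem_m hx ha), rfl⟩) hy
  have h : z = ⁅x, y⁆ := h
  rwa [← h]

lemma nHat_le_radical {x : g} (hx : x ∈ nHat K m) : x ∈ radical K g := by
  have : nHat K m ≤ (radical K g).toLieSubalgebra :=
    LieSubalgebra.lieSpan_le.mpr fun z hz => T.m_le_radical hz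
  exact this hx

/-- A Levi subalgebra is semisimple. -/
lemma hasTrivialRadical [FiniteDimensional K g] : HasTrivialRadical K s := by
  refine hasTrivialRadical_of_no_solvable_ideals fun I hI => ?_
  let E : LieIdeal K s → LieIdeal K g := fun I =>
    { carrier := {z | ∃ a ∈ I, z - (a : g) ∈ radical K g}
      zero_mem' := ⟨0, zero_mem _, by simp⟩
      add_mem' := by
        rintro z w ⟨a, ha, hz⟩ ⟨b, hb, hw⟩
        refine ⟨a + b, add_mem ha hb, ?_⟩
        have := add_mem hz hw
        rwa [show z - (a : g) + (w - (b : g)) = z + w - ((a + b : s) : g) by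
          rw [AddMemClass.coe_add]; abel] at this
      smul_mem' := by
        rintro c z ⟨a, ha, hz⟩
        refine ⟨c • a, SMulMemClass.smul_mem c ha, ?_⟩
        have := SMulMemClass.smul_mem c hz
        rwa [smul_sub] at this
      lie_mem := by
        rintro y z ⟨a, ha, hz⟩
        obtain ⟨b, hb, r, hr, rfl⟩ := T.exists_add_eq y
        refine ⟨⁅(⟨b, hb⟩ : s), a⁆, lie_mem_right K s _ _ _ ha, ?_⟩
        have : ⁅b, z - (a : g)⁆ + ⁅r, z⁆ ∈ radical K g :=
          add_mem (lie_mem_right K g _ _ _ hz) (lie_mem_left K g _ _ _ hr)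
        rwa [show ⁅b, z - (a : g)⁆ + ⁅r, z⁆ = ⁅b + r, z⁆ - ((⁅(⟨b, hb⟩ : s), a⁆ : s) : g) by
          rw [lie_sub, add_lie, LieSubalgebra.coe_bracket]; abel] at this }
  have hE : ∀ I J, ⁅E I, E J⁆ ≤ E ⁅I, J⁆ := by
    intro I J
    rw [LieSubmodule.lie_le_iff]
    rintro z ⟨a, ha, hz⟩ w ⟨b, hb, hw⟩
    refine ⟨⁅a, b⁆, LieSubmodule.lie_mem_lie ha hb, ?_⟩
    have : ⁅z - (a : g), w⁆ + ⁅(a : g), w - (b : g)⁆ ∈ radical K g :=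
      add_mem (lie_mem_left K g _ _ _ hz) (lie_mem_right K g _ _ _ hw)
    rwa [show ⁅z - (a : g), w⁆ + ⁅(a : g), w - (b : g)⁆ = ⁅z, w⁆ - ((⁅a, b⁆ : s) : g) by
      rw [lie_sub, sub_lie, LieSubalgebra.coe_bracket]; abel] at this
  have hEk : ∀ n, derivedSeriesOfIdeal K g n (E I) ≤ E (derivedSeriesOfIdeal K s n I) := by
    intro n
    induction n with
    | zero => simp
    | succ n ih =>
      rw [derivedSeriesOfIdeal_succ, derivedSeriesOfIdeal_succ]
      exact (LieSubmodule.mono_lie ih ih).trans (hE _ _)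
  obtain ⟨n, hn⟩ := hI.solvable K
  rw [LieIdeal.derivedSeries_eq_bot_iff] at hn
  have hE0 : derivedSeriesOfIdeal K g n (E I) ≤ radical K g := by
    refine (hEk n).trans ?_
    rw [hn]
    rintro z ⟨a, ha, hz⟩
    rw [LieSubmodule.mem_bot] at ha
    simpa [ha] using hz
  obtain ⟨j, hj⟩ := IsSolvable.solvable K (radical K g)
  rw [LieIdeal.derivedSeries_eq_bot_iff] at hj
  have hsolv : IsSolvable (E I) := by
    refine IsSolvable.mk (R := K) (k := j + n)
      ((LieIdeal.derivedSeries_eq_bot_iff (E I) (j + n)).mpr ?_)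
    rw [derivedSeriesOfIdeal_add, ← le_bot_iff, ← hj]
    exact derivedSeriesOfIdeal_mono hE0 j
  have hle := (LieIdeal.solvable_iff_le_radical K g (E I)).mp hsolv
  rw [LieSubmodule.eq_bot_iff]
  intro a ha
  exact Subtype.ext (T.eq_zero_of_mem a.2 (hle ⟨a, ha, by simp⟩))

lemma k_le_nullPart (hk : LieRing.IsNilpotent k) {b : g} (hb : b ∈ k) : b ∈ nullPart K s k g := by
  refine mem_nullPart.mpr ⟨fun a => T.lie_eq_zero a a.2 b hb, ?_⟩
  obtain ⟨n, hn⟩ := exists_forall_pow_toEnd_eq_zero K k k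
  rw [mem_genWeightSpace]
  intro x
  refine ⟨n, ?_⟩
  have h : ∀ j, (toEnd K k g x ^ j) b = ((toEnd K k k x ^ j) ⟨b, hb⟩ : k) := by
    intro j
    induction j with
    | zero => rfl
    | succ j ih => rw [pow_succ', pow_succ', Module.End.mul_apply, ih]; rfl
  simp [h, hn]

lemma nHat_mem_lowerCentralLimit {x : g} (hx : x ∈ nHat K m) : x ∈ lowerCentralLimit K g := by
  have hm : ∀ n, m ≤ (lowerCentralSeries K g g n).toSubmodule := by
    intro n
    induction n with
    | zero => exact fun x _ => trivial
    | succ n ih =>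
      refine T.m_le fun x _ y hy => ?_
      rw [LieSubmodule.mem_toSubmodule, LieModule.lowerCentralSeries_succ]
      exact LieSubmodule.lie_mem_lie trivial (ih hy)
  have : nHat K m ≤ (lowerCentralLimit K g).toLieSubalgebra :=
    LieSubalgebra.lieSpan_le.mpr fun z hz => mem_lowerCentralLimit.mpr fun n => hm n hz
  exact this hx

/-- `C^∞(g) ⊆ s + n̂`. -/
lemma exists_add_eq_of_mem_lowerCentralLimit {x : g} (hx : x ∈ lowerCentralLimit K g) :
    ∃ a ∈ s, ∃ b ∈ nHat K m, a + b = x := by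
  let I : Submodule K g := s.toSubmodule ⊔ (nHat K m).toSubmodule
  have hI : ∀ (y : g), ∀ z ∈ I, ⁅y, z⁆ ∈ I := by
    intro y z hz
    obtain ⟨a, ha, b, hb, c, hc, rfl⟩ := T.exists_add_add_eq y
    obtain ⟨a', ha', n, hn, rfl⟩ := Submodule.mem_sup.mp hz
    have hb0 : ⁅b, a'⁆ = 0 := by rw [← lie_skew, T.lie_eq_zero a' ha' b hb, neg_zero]
    have h1 : ⁅a + b, n⁆ ∈ nHat K m :=
      T.lie_mem_nHat (add_mem (Submodule.mem_sup_left ha) (Submodule.mem_sup_right hb)) hn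
    have h2 : ⁅c, n⁆ ∈ nHat K m := (nHat K m).lie_mem (LieSubalgebra.subset_lieSpan hc) hn
    have h3 : ⁅c, a'⁆ ∈ nHat K m := by
      rw [← lie_skew]
      exact neg_mem (LieSubalgebra.subset_lieSpan (T.lie_mem_m (Submodule.mem_sup_left ha') hc))
    have h4 : ⁅a + b + c, a' + n⁆ = ⁅a, a'⁆ + (⁅a + b, n⁆ + ⁅c, n⁆ + ⁅c, a'⁆) := by
      simp only [lie_add, add_lie, hb0]
      abel
    rw [h4]
    exact Submodule.add_mem_sup (s.lie_mem ha ha') (add_mem (add_mem h1 h2) h3)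
  have key : ∀ n, ∀ z ∈ lowerCentralSeries K g g n,
      ∃ b ∈ lowerCentralSeries K k k n, z - (b : g) ∈ I := by
    intro n
    induction n with
    | zero =>
      intro z _
      obtain ⟨a, ha, b, hb, c, hc, rfl⟩ := T.exists_add_add_eq z
      refine ⟨⟨b, hb⟩, trivial, ?_⟩
      rw [show a + b + c - b = a + c by abel]
      exact Submodule.add_mem_sup ha (LieSubalgebra.subset_lieSpan hc)
    | succ n ih =>
      intro z hz
      let N : Submodule K g :=
        { carrier := {z | ∃ b ∈ lowerCentralSeries K k k (n + 1), z - (b : g) ∈ I}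
          zero_mem' := ⟨0, zero_mem _, by simp⟩
          add_mem' := by
            rintro z w ⟨a, ha, hz⟩ ⟨b, hb, hw⟩
            refine ⟨a + b, add_mem ha hb, ?_⟩
            have := add_mem hz hw
            rwa [show z - (a : g) + (w - (b : g)) = z + w - ((a + b : k) : g) by
              rw [AddMemClass.coe_add]; abel] at this
          smul_mem' := by
            rintro c z ⟨a, ha, hz⟩
            refine ⟨c • a, SMulMemClass.smul_mem c ha, ?_⟩
            have := I.smul_mem c hz
            rwa [smul_sub] at this }
      refine lowerCentralSeries_succ_induction (N := N) (fun y w hw => ?_) hz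
      obtain ⟨b, hb, hbI⟩ := ih w hw
      obtain ⟨b', -, hbI'⟩ : ∃ b' ∈ lowerCentralSeries K k k 0, y - (b' : g) ∈ I := by
        obtain ⟨a, ha, b, hb, c, hc, rfl⟩ := T.exists_add_add_eq y
        refine ⟨⟨b, hb⟩, trivial, ?_⟩
        rw [show a + b + c - b = a + c by abel]
        exact Submodule.add_mem_sup ha (LieSubalgebra.subset_lieSpan hc)
      refine ⟨⁅b', b⁆, ?_, ?_⟩
      · rw [LieModule.lowerCentralSeries_succ]
        exact LieSubmodule.lie_mem_lie trivial hb
      · have h5 : ⁅y, w⁆ - ((⁅b', b⁆ : k) : g) = -⁅(b : g), y - b'⁆ + ⁅y, w - (b : g)⁆ := by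
          rw [LieSubalgebra.coe_bracket, lie_sub, lie_sub, ← lie_skew (b : g) y,
            ← lie_skew (b : g) (b' : g)]
          abel
        rw [h5]
        exact add_mem (neg_mem (hI _ _ hbI')) (hI _ _ hbI)
  have hk := T.nilpotent
  obtain ⟨n, hn⟩ := IsNilpotent.nilpotent (R := K) (L := k) (M := k)
  obtain ⟨b, hb, hbI⟩ := key n x (mem_lowerCentralLimit.mp hx n)
  rw [hn, LieSubmodule.mem_bot] at hb
  rw [hb, ZeroMemClass.coe_zero, sub_zero] at hbI
  exact Submodule.mem_sup.mp hbI

end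

variable [CharZero K] [FiniteDimensional K g] (T : IsGammaTriple K s k m)
include T

lemma lowerCentralSeries_one_eq_top : lowerCentralSeries K s s 1 = ⊤ :=
  have := T.hasTrivialRadical
  lowerCentralSeries_one_eq_top_of_hasTrivialRadical

lemma s_le_lowerCentralSeries {a : g} (ha : a ∈ s) (n : ℕ) : a ∈ lowerCentralSeries K s g n := by
  have h : (⟨a, ha⟩ : s) ∈ lowerCentralSeries K s s 1 := by rw [T.lowerCentralSeries_one_eq_top]; trivial
  exact lowerCentralSeries_succ_induction (n := 0)
    (N := (lowerCentralSeries K s g n).toSubmodule.comap s.toSubmodule.subtype)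
    (fun x y _ => lie_mem_lowerCentralSeries_of_perfect T.lowerCentralSeries_one_eq_top n x (y : g)) h

lemma s_mem_lowerCentralLimit {a : g} (ha : a ∈ s) : a ∈ lowerCentralLimit K g :=
  mem_lowerCentralLimit.mpr fun n => s.lowerCentralSeries_le n (T.s_le_lowerCentralSeries ha n)

lemma le_movedPart [LieRing.IsNilpotent k] : s.toSubmodule ⊔ m ≤ movedPart K s k g := by
  refine sup_le (fun a ha => Submodule.mem_sup_left (T.s_le_lowerCentralSeries ha 1)) ?_
  have key : ∀ n, m ≤ (lowerCentralSeries K s g 1).toSubmodule ⊔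
      (lowerCentralSeries K k g n).toSubmodule := by
    intro n
    induction n with
    | zero => simp
    | succ n ih =>
      refine T.m_le fun x hx y hy => ?_
      obtain ⟨a, ha, b, hb, rfl⟩ := Submodule.mem_sup.mp hx
      rw [add_lie]
      refine add_mem (Submodule.mem_sup_left ?_) ?_
      · rw [LieSubmodule.mem_toSubmodule, LieModule.lowerCentralSeries_succ]
        exact LieSubmodule.lie_mem_lie (x := (⟨a, ha⟩ : s)) trivial trivial
      · obtain ⟨y₁, h₁, y₂, h₂, rfl⟩ := Submodule.mem_sup.mp (ih hy)
        rw [lie_add]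
        refine Submodule.add_mem_sup ?_ ?_
        · refine lowerCentralSeries_succ_induction (n := 0)
            (N := (lowerCentralSeries K s g 1).toSubmodule.comap (LieAlgebra.ad K g b))
            (fun a z _ => ?_) h₁
          rw [Submodule.mem_comap, LieAlgebra.ad_apply]
          have : ⁅b, ⁅a, z⁆⁆ = ⁅a, ⁅b, z⁆⁆ := by
            have h0 : ⁅b, (a : g)⁆ = 0 := by rw [← lie_skew, T.lie_eq_zero a a.2 b hb, neg_zero]
            change ⁅b, ⁅(a : g), z⁆⁆ = ⁅(a : g), ⁅b, z⁆⁆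
            rw [leibniz_lie, h0, zero_lie, zero_add]
          rw [this, LieSubmodule.mem_toSubmodule, LieModule.lowerCentralSeries_succ]
          exact LieSubmodule.lie_mem_lie trivial trivial
        · rw [LieSubmodule.mem_toSubmodule, LieModule.lowerCentralSeries_succ]
          exact LieSubmodule.lie_mem_lie (x := (⟨b, hb⟩ : k)) trivial h₂
  obtain ⟨n, hn⟩ := Filter.eventually_atTop.mp (eventually_iInf_lowerCentralSeries_eq K k g)
  have := key n
  rwa [← hn n le_rfl, iInf_lowerCentralSeries_eq_posFittingComp] at this

end IsGammaTriple

lemma Module.End.exists_isJordanDecomposition {K V : Type*} [Field K] [PerfectField K]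
    [AddCommGroup V] [Module K V] [FiniteDimensional K V] (x : Module.End K V) :
    ∃ u v, IsJordanDecomposition x u v := by
  obtain ⟨n, hn, s, hs, hn_nil, hs_ss, hx⟩ := x.exists_isNilpotent_isSemisimple
  have h1 : Commute x s := Algebra.commute_of_mem_adjoin_self hs
  have h2 : n = x - s := by rw [hx, add_sub_cancel_right]
  refine ⟨s, n, hs_ss, hn_nil, ?_, by rw [hx, add_comm]⟩
  rw [h2]
  exact h1.symm.sub_right (Commute.refl s)

/-- The centralizer of `C^∞(g)`. -/
def lowerCentralLimitCentralizer (K g : Type*) [Field K] [LieRing g] [LieAlgebra K g] :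
    LieSubmodule K g g where
  carrier := {y | ∀ x ∈ lowerCentralLimit K g, ⁅x, y⁆ = 0}
  zero_mem' := by simp
  add_mem' := fun {a b} ha hb x hx => by rw [lie_add, ha x hx, hb x hx, add_zero]
  smul_mem' := fun c a ha x hx => by rw [lie_smul, ha x hx, smul_zero]
  lie_mem := fun {a b} hb x hx => by
    have hxa : ⁅x, a⁆ ∈ lowerCentralLimit K g := lie_mem_left K g _ _ _ hx
    rw [leibniz_lie, hb _ hxa, hb x hx, lie_zero, add_zero]

namespace LieModule

variable {K g V W : Type*} [Field K] [LieRing g] [LieAlgebra K g] {s k : LieSubalgebra K g}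
  [LieRing.IsNilpotent k] [AddCommGroup V] [Module K V] [LieRingModule g V] [LieModule K g V]
  [AddCommGroup W] [Module K W] [LieRingModule g W] [LieModule K g W]

lemma map_mem_nullPart (f : V →ₗ⁅K,g⁆ W) {v : V} (hv : v ∈ nullPart K s k V) :
    f v ∈ nullPart K s k W := by
  obtain ⟨h₁, h₂⟩ := mem_nullPart.mp hv
  let f' : V →ₗ⁅K,k⁆ W := { (f : V →ₗ[K] W) with map_lie' := fun {b v} => f.map_lie b v }
  refine mem_nullPart.mpr ⟨fun a => ?_, map_genWeightSpace_le f'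
    ((LieSubmodule.mem_map _).mpr ⟨v, h₂, rfl⟩)⟩
  have := f.map_lie (a : g) v
  rw [show ⁅(a : g), v⁆ = 0 from h₁ a, map_zero] at this
  exact this.symm

lemma map_mem_movedPart (f : V →ₗ⁅K,g⁆ W) {v : V} (hv : v ∈ movedPart K s k V) :
    f v ∈ movedPart K s k W := by
  let f' : V →ₗ⁅K,k⁆ W := { (f : V →ₗ[K] W) with map_lie' := fun {b v} => f.map_lie b v }
  let f'' : V →ₗ⁅K,s⁆ W := { (f : V →ₗ[K] W) with map_lie' := fun {b v} => f.map_lie b v }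
  obtain ⟨a, ha, b, hb, rfl⟩ := Submodule.mem_sup.mp hv
  rw [map_add]
  exact Submodule.add_mem_sup
    (map_lowerCentralSeries_le 1 f'' ((LieSubmodule.mem_map _).mpr ⟨a, ha, rfl⟩))
    (map_posFittingComp_le f' ((LieSubmodule.mem_map _).mpr ⟨b, hb, rfl⟩))

end LieModule

namespace IsGammaTriple

open LieAlgebra

variable {K : Type*} [Field K] {g : Type*} [LieRing g] [LieAlgebra K g]
  {s k : LieSubalgebra K g} {m : Submodule K g} (T : IsGammaTriple K s k m)
include T

lemma lie_lie_comm {V : Type*} [AddCommGroup V] [Module K V] [LieRingModule g V] [LieModule K g V]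
    (a : s) (b : k) (v : V) : ⁅a, ⁅b, v⁆⁆ = ⁅b, ⁅a, v⁆⁆ := by
  change ⁅(a : g), ⁅(b : g), v⁆⁆ = ⁅(b : g), ⁅(a : g), v⁆⁆
  rw [leibniz_lie, T.lie_eq_zero a a.2 b b.2, zero_lie, zero_add]

lemma eq_zero_of_mem_centralizer [FiniteDimensional K g] [LieRing.IsNilpotent k]
    (hZ : center K g = ⊥) {z : g} (hz : z ∈ lowerCentralLimitCentralizer K g)
    (hs : ∀ z ∈ lowerCentralLimitCentralizer K g, ∀ a ∈ s, ⁅a, z⁆ = 0)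
    (hz' : z ∈ genWeightSpace g (0 : k → K)) : z = 0 := by
  let W : LieSubmodule K k g := genWeightSpace g (0 : k → K) ⊓
    { (lowerCentralLimitCentralizer K g).toSubmodule with
      lie_mem := fun {x y} hy => (lowerCentralLimitCentralizer K g).lie_mem (x := (x : g)) hy }
  have hzW : z ∈ W := ⟨hz', hz⟩
  by_contra hne
  have hnt : Nontrivial W := ⟨⟨z, hzW⟩, 0, fun h => hne (congrArg Subtype.val h)⟩
  have hnil : LieModule.IsNilpotent k W :=
    isNilpotent_of_le K k g W (genWeightSpace g (0 : k → K)) inf_le_left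
  have hnt' := nontrivial_max_triv_of_isNilpotent K k W
  obtain ⟨⟨⟨w, hw⟩, hwk⟩, hw0⟩ := exists_ne (0 : maxTrivSubmodule K k W)
  rw [mem_maxTrivSubmodule] at hwk
  apply hw0
  have hwc : w ∈ center K g := by
    rw [mem_maxTrivSubmodule]
    intro x
    obtain ⟨a, ha, b, hb, c, hc, rfl⟩ := T.exists_add_add_eq x
    have hb0 : ⁅b, w⁆ = 0 := congrArg (fun v : W => (v : g)) (hwk ⟨b, hb⟩)
    rw [add_lie, add_lie, hs w hw.2 a ha, hb0,
      hw.2 c (T.nHat_mem_lowerCentralLimit (LieSubalgebra.subset_lieSpan hc)), add_zero, add_zero]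
  rw [hZ, LieSubmodule.mem_bot] at hwc
  exact Subtype.ext (Subtype.ext hwc)

end IsGammaTriple

lemma finrank_prod_gammaB {K g : Type*} [Field K] [LieRing g] [LieAlgebra K g]
    [FiniteDimensional K g] (s k : LieSubalgebra K g) (m : Submodule K g) :
    Module.finrank K (s × gammaB K s k m × m) =
      Module.finrank K s + (Module.finrank K (gammaB K s k m) + Module.finrank K m) := by
  have : Module.Free K (gammaB K s k m) :=
    .of_basis (Module.Basis.ofVectorSpace K (gammaB K s k m))
  rw [Module.finrank_prod, Module.finrank_prod]

namespace IsSubinvariantEmbedding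

open LieAlgebra

variable {K g L : Type*} [Field K] [CharZero K] [LieRing g] [LieAlgebra K g]
    [LieRing L] [LieAlgebra K L] [LieRingModule g L] [LieModule K g L] {ι : g →ₗ⁅K⁆ L}
    (h : IsSubinvariantEmbedding ι)

include h

/-- Elements of `C^∞(g)` that are in the radical of `g` are mapped by `L` into this radical. -/
lemma mem_radical_of_lie_eq [FiniteDimensional K g] {x z : g} (hx : x ∈ lowerCentralLimit K g)
    (hxr : x ∈ radical K g) {y : L} (hz : ι z = ⁅y, ι x⁆) : z ∈ radical K g := by
  set J := lowerCentralLimit K g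
  obtain ⟨φ, hφ⟩ := h.exists_linearMap_derivation
  let I : LieIdeal K J := (radical K g).comap J.incl
  have hI : IsSolvable I := by
    let f : I →ₗ⁅K⁆ radical K g :=
      { toFun := fun w => ⟨(w : J), w.2⟩
        map_add' := fun _ _ => rfl
        map_smul' := fun _ _ => rfl
        map_lie' := fun {_ _} => rfl }
    have hf : Function.Injective f := fun a b hab =>
      Subtype.ext (Subtype.ext (congrArg (fun w : radical K g => (w : g)) hab))
    exact hf.lieAlgebra_isSolvable
  have hle : I ≤ radical K J := (LieIdeal.solvable_iff_le_radical K J I).mp hI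
  let E : LieIdeal K g :=
    { (radical K J).toSubmodule.map J.toSubmodule.subtype with
      lie_mem := by
        rintro w - ⟨v, hv, rfl⟩
        refine ⟨φ (ι w) v, (φ (ι w)).apply_mem_radical hv, h.injective ?_⟩
        rw [LieHom.map_lie]
        exact hφ (ι w) v }
  have hE : IsSolvable E := by
    have hEJ : ∀ w : E, ∃ v ∈ radical K J, (v : g) = w := fun w => w.2
    choose f hf hfw using hEJ
    let F : E →ₗ⁅K⁆ radical K J :=
      { toFun := fun w => ⟨f w, hf w⟩
        map_add' := fun a b => Subtype.ext (Subtype.ext (by simp [hfw]))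
        map_smul' := fun c a => Subtype.ext (Subtype.ext (by simp [hfw]))
        map_lie' := fun {a b} => Subtype.ext (Subtype.ext (by
          change (f ⁅a, b⁆ : g) = ⁅(f a : g), (f b : g)⁆
          rw [hfw, hfw, hfw]
          rfl)) }
    have hF : Function.Injective F := fun a b hab => by
      apply Subtype.ext
      rw [← hfw a, ← hfw b]
      exact congrArg (fun w : radical K J => ((w : J) : g)) hab
    exact hF.lieAlgebra_isSolvable
  have hEr : E ≤ radical K g := (LieIdeal.solvable_iff_le_radical K g E).mp hE
  have hzx : z = (φ y ⟨x, hx⟩ : J) := h.injective (by rw [hφ, hz])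
  rw [hzx]
  exact hEr ⟨_, (φ y).apply_mem_radical (hle hxr), rfl⟩

variable [FiniteDimensional K L] {s k : LieSubalgebra K g} {m : Submodule K g}
  (T : IsGammaTriple K s k m) [LieRing.IsNilpotent k]

omit [CharZero K] [FiniteDimensional K L] in
lemma map_mem_nullPart {x : g} (hx : x ∈ nullPart K s k g) : ι x ∈ nullPart K s k L :=
  LieModule.map_mem_nullPart
    ({ (ι : g →ₗ[K] L) with map_lie' := fun {x y} => h.map_lie x y } : g →ₗ⁅K,g⁆ L) hx

omit [CharZero K] [FiniteDimensional K L] in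
lemma map_mem_movedPart {x : g} (hx : x ∈ movedPart K s k g) : ι x ∈ movedPart K s k L :=
  LieModule.map_mem_movedPart
    ({ (ι : g →ₗ[K] L) with map_lie' := fun {x y} => h.map_lie x y } : g →ₗ⁅K,g⁆ L) hx

include T

lemma isCompl_nullPart_movedPart : IsCompl (nullPart K s k L) (movedPart K s k L) := by
  have hfin : FiniteDimensional K g := FiniteDimensional.of_injective (ι : g →ₗ[K] L) h.injective
  have := T.hasTrivialRadical
  exact LieModule.isCompl_nullPart_movedPart T.lie_lie_comm

lemma movedPart_eq : movedPart K s k L = (s.toSubmodule ⊔ m).map (ι : g →ₗ[K] L) := by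
  have hfin : FiniteDimensional K g := FiniteDimensional.of_injective (ι : g →ₗ[K] L) h.injective
  have hge : (s.toSubmodule ⊔ m).map (ι : g →ₗ[K] L) ≤ movedPart K s k L := by
    rintro - ⟨x, hx, rfl⟩
    exact h.map_mem_movedPart (T.le_movedPart hx)
  refine le_antisymm (fun v hv => ?_) hge
  obtain ⟨r, hr⟩ := h.exists_lcs_le
  obtain ⟨x, rfl⟩ : ∃ x, ι x = v := by
    refine hr v ((?_ : movedPart K s k L ≤ (lowerCentralSeries K g L r).toSubmodule) hv)
    refine sup_le (fun w hw => ?_) (fun w hw => ?_)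
    · exact lowerCentralSeries_succ_induction (n := 0) (fun x y _ => s.lowerCentralSeries_le r
        (lie_mem_lowerCentralSeries_of_perfect T.lowerCentralSeries_one_eq_top r x y)) hw
    · exact k.lowerCentralSeries_le r ((LieSubmodule.mem_iInf _).mp
        (posFittingComp_le_iInf_lowerCentralSeries K k L hw) r)
  obtain ⟨a, ha, b, hb, c, hc, rfl⟩ := T.exists_add_add_eq x
  have hac : a + c ∈ s.toSubmodule ⊔ m := Submodule.add_mem_sup ha hc
  have hb0 : ι b = 0 := by
    refine Submodule.disjoint_def.mp (h.isCompl_nullPart_movedPart T).disjoint _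
      (h.map_mem_nullPart (T.k_le_nullPart ‹_› hb)) ?_
    have := sub_mem hv (hge ⟨a + c, hac, rfl⟩)
    rwa [show ι (a + b + c) - (ι : g →ₗ[K] L) (a + c) = ι b by simp] at this
  exact ⟨a + c, hac, by simp [hb0]⟩

omit T in
lemma lie_mem_movedPart {y : L} (hy : y ∈ nullPart K s k L) {v : L}
    (hv : v ∈ movedPart K s k L) : ⁅y, v⁆ ∈ movedPart K s k L := by
  obtain ⟨hys, hyk⟩ := mem_nullPart.mp hy
  obtain ⟨a, ha, b, hb, rfl⟩ := Submodule.mem_sup.mp hv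
  rw [lie_add]
  refine Submodule.add_mem_sup ?_ ?_
  · refine lowerCentralSeries_succ_induction (n := 0)
      (N := (lowerCentralSeries K s L 1).toSubmodule.comap (LieAlgebra.ad K L y))
      (fun a z _ => ?_) ha
    rw [Submodule.mem_comap, LieAlgebra.ad_apply]
    have h1 : ⁅y, ⁅a, z⁆⁆ = ⁅a, ⁅y, z⁆⁆ := by
      change ⁅y, ⁅(a : g), z⁆⁆ = ⁅(a : g), ⁅y, z⁆⁆
      have h0 : ⁅ι a, y⁆ = 0 := (h.lie_apply a y).trans (hys a)
      rw [← h.lie_apply, ← h.lie_apply, leibniz_lie (ι a), h0, zero_lie, zero_add]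
    rw [h1, LieSubmodule.mem_toSubmodule, LieModule.lowerCentralSeries_succ]
    exact LieSubmodule.lie_mem_lie trivial trivial
  · refine (?_ : (posFittingComp K k L).toSubmodule ≤
      (posFittingComp K k L).toSubmodule.comap (LieAlgebra.ad K L y)) hb
    rw [posFittingComp, LieSubmodule.iSup_toSubmodule, iSup_le_iff]
    intro x w hw
    rw [Submodule.mem_comap, LieAlgebra.ad_apply]
    refine Submodule.mem_iSup_of_mem x ?_
    obtain ⟨u, v, hJ⟩ := (toEnd K k L x).exists_isJordanDecomposition
    obtain ⟨w, rfl⟩ := hJ.exists_apply_eq ((mem_posFittingCompOf K x w).mp hw)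
    have huy : u y = 0 := by
      obtain ⟨n, hn⟩ := (mem_genWeightSpace _ _ _).mp hyk x
      exact hJ.apply_eq_zero n (by simpa using hn)
    have hu := hJ.apply_lie (fun a b => by
      change ⁅(x : g), ⁅a, b⁆⁆ = ⁅⁅(x : g), a⁆, b⁆ + ⁅a, ⁅(x : g), b⁆⁆
      rw [← h.lie_apply, ← h.lie_apply, ← h.lie_apply, leibniz_lie]) y w
    rw [huy, zero_lie, zero_add] at hu
    rw [← hu, LieSubmodule.mem_toSubmodule, mem_posFittingCompOf]
    exact hJ.exists_pow_apply_eq _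

lemma exists_lie_eq_of_mem_nullPart {y : L} (hy : y ∈ nullPart K s k L) {c : g} (hc : c ∈ m) :
    ∃ c' ∈ m, ι c' = ⁅y, ι c⁆ := by
  have hfin : FiniteDimensional K g := FiniteDimensional.of_injective (ι : g →ₗ[K] L) h.injective
  have hmv : ⁅y, ι c⁆ ∈ movedPart K s k L :=
    h.lie_mem_movedPart hy (h.map_mem_movedPart (T.le_movedPart (Submodule.mem_sup_right hc)))
  rw [h.movedPart_eq T] at hmv
  obtain ⟨z, hz, hzy⟩ := hmv
  obtain ⟨a, ha, d, hd, rfl⟩ := Submodule.mem_sup.mp hz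
  have hr := h.mem_radical_of_lie_eq
    (T.nHat_mem_lowerCentralLimit (LieSubalgebra.subset_lieSpan hc)) (T.m_le_radical hc) hzy
  have ha0 : a = 0 := T.eq_zero_of_mem ha (by
    have := sub_mem hr (T.m_le_radical hd)
    rwa [add_sub_cancel_right] at this)
  rw [ha0, zero_add] at hzy
  exact ⟨d, hd, hzy⟩

omit T in
lemma gammaOf_comm {y : L} (hy : y ∈ nullPart K s k L) {γ : Module.End K g}
    (hγ : γ ∈ gammaOf K s k) : ∀ z w : g, ι w = ⁅y, ι z⁆ → ι (γ w) = ⁅y, ι (γ z)⁆ := by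
  have hfin : FiniteDimensional K g := FiniteDimensional.of_injective (ι : g →ₗ[K] L) h.injective
  obtain ⟨hys, hyk⟩ := mem_nullPart.mp hy
  let Γ : Submodule K (Module.End K g) :=
    { carrier := {γ | ∀ z w : g, ι w = ⁅y, ι z⁆ → ι (γ w) = ⁅y, ι (γ z)⁆}
      zero_mem' := fun z w _ => by simp
      add_mem' := fun {a b} ha hb z w hzw => by simp [ha z w hzw, hb z w hzw]
      smul_mem' := fun c a ha z w hzw => by simp [ha z w hzw] }
  refine (?_ : gammaOf K s k ≤ Γ) hγ
  refine sup_le (Submodule.span_le.mpr ?_) (Submodule.span_le.mpr ?_)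
  · rintro - ⟨a, ha, rfl⟩ z w hzw
    have h0 : ⁅ι a, y⁆ = 0 := (h.lie_apply a y).trans (hys ⟨a, ha⟩)
    rw [LieAlgebra.ad_apply, LieAlgebra.ad_apply, LieHom.map_lie, LieHom.map_lie, hzw,
      leibniz_lie, h0, zero_lie, zero_add]
  · rintro u ⟨x, hx, v, hu, hv, huv, hxuv⟩ z w hzw
    have hJ : IsJordanDecomposition (LieAlgebra.ad K g x) u v := ⟨hu, hv, huv, hxuv⟩
    obtain ⟨u', v', hJ'⟩ := (toEnd K g L x).exists_isJordanDecomposition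
    have hι : ∀ a, ι (u a) = u' (ι a) :=
      hJ.apply_comm hJ' (f := (ι : g →ₗ[K] L)) (fun a => h.map_lie x a)
    have huy : u' y = 0 := by
      obtain ⟨n, hn⟩ := (mem_genWeightSpace _ _ _).mp hyk ⟨x, hx⟩
      refine hJ'.apply_eq_zero n ?_
      simpa using hn
    have hu := hJ'.apply_lie (fun a b => by
      change ⁅(x : g), ⁅a, b⁆⁆ = ⁅⁅(x : g), a⁆, b⁆ + ⁅a, ⁅(x : g), b⁆⁆
      rw [← h.lie_apply, ← h.lie_apply, ← h.lie_apply, leibniz_lie]) y (ι z)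
    rw [hι, hzw, hu, huy, zero_lie, zero_add, hι]

lemma eq_zero_of_mem_nullPart {y : L} (hy : y ∈ nullPart K s k L)
    (hym : ∀ c ∈ m, ⁅y, ι c⁆ = 0) : y = 0 := by
  have hfin : FiniteDimensional K g := FiniteDimensional.of_injective (ι : g →ₗ[K] L) h.injective
  obtain ⟨hys, hyk⟩ := mem_nullPart.mp hy
  have hn : ∀ x ∈ nHat K m, ⁅y, ι x⁆ = 0 := by
    let A : LieSubalgebra K g :=
      { carrier := {x | ⁅y, ι x⁆ = 0}
        zero_mem' := by simp
        add_mem' := fun {a b} ha hb => by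
          change ⁅y, ι (a + b)⁆ = 0
          rw [map_add, lie_add, show ⁅y, ι a⁆ = 0 from ha, show ⁅y, ι b⁆ = 0 from hb, add_zero]
        smul_mem' := fun c a ha => by
          change ⁅y, ι (c • a)⁆ = 0
          rw [map_smul, lie_smul, show ⁅y, ι a⁆ = 0 from ha, smul_zero]
        lie_mem' := fun {a b} ha hb => by
          change ⁅y, ι ⁅a, b⁆⁆ = 0
          rw [LieHom.map_lie, leibniz_lie, show ⁅y, ι a⁆ = 0 from ha,
            show ⁅y, ι b⁆ = 0 from hb, zero_lie, lie_zero, add_zero] }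
    have : nHat K m ≤ A := LieSubalgebra.lieSpan_le.mpr hym
    exact fun x hx => this hx
  obtain ⟨z, -, rfl⟩ := h.exists_eq_of_lie_eq_zero (y := y) (fun x hx => by
    obtain ⟨a, ha, b, hb, rfl⟩ := T.exists_add_eq_of_mem_lowerCentralLimit hx
    have ha0 : ⁅a, y⁆ = 0 := hys ⟨a, ha⟩
    rw [add_lie, ha0, ← h.lie_apply b, ← lie_skew, hn b hb, neg_zero, add_zero])
  have hZ : center K g = ⊥ := by
    rw [LieSubmodule.eq_bot_iff]
    intro x hx
    rw [mem_maxTrivSubmodule] at hx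
    apply h.injective
    rw [map_zero]
    exact h.eq_zero _ fun w => by rw [← h.map_lie, hx, map_zero]
  have hz0 : z = 0 := by
    refine T.eq_zero_of_mem_centralizer hZ (fun x hx => ?_)
      (fun w hw a ha => hw a (T.s_mem_lowerCentralLimit ha)) ?_
    · obtain ⟨a, ha, b, hb, rfl⟩ := T.exists_add_eq_of_mem_lowerCentralLimit hx
      apply h.injective
      have ha0 : ⁅a, ι z⁆ = 0 := hys ⟨a, ha⟩
      rw [h.map_lie, map_zero, add_lie, ha0, ← h.lie_apply b, ← lie_skew, hn b hb, neg_zero,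
        add_zero]
    · rw [mem_genWeightSpace] at hyk ⊢
      intro x
      obtain ⟨n, hn⟩ := hyk x
      refine ⟨n, h.injective ?_⟩
      have hpow : ∀ j, ι ((toEnd K k g x ^ j) z) = (toEnd K k L x ^ j) (ι z) := by
        intro j
        induction j with
        | zero => rfl
        | succ j ih =>
          rw [pow_succ', pow_succ', Module.End.mul_apply, Module.End.mul_apply, ← ih]
          exact h.map_lie x _
      simp only [Pi.zero_apply, zero_smul, sub_zero] at hn ⊢
      rw [hpow, hn, map_zero]
  rw [hz0, map_zero]

lemma finrank_nullPart_le : Module.finrank K (nullPart K s k L) ≤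
    Module.finrank K (gammaB K s k m) := by
  have hfin : FiniteDimensional K g := FiniteDimensional.of_injective (ι : g →ₗ[K] L) h.injective
  have hex : ∀ (y : nullPart K s k L) (c : m), ∃ c' : m, ι c' = ⁅(y : L), ι c⁆ := fun y c => by
    obtain ⟨c', hc', hcy⟩ := h.exists_lie_eq_of_mem_nullPart T y.2 c.2
    exact ⟨⟨c', hc'⟩, hcy⟩
  choose f hf using hex
  have hinj : ∀ a b : m, ι (a : g) = ι (b : g) → a = b :=
    fun a b hab => Subtype.ext (h.injective hab)
  let F : nullPart K s k L → Module.End K m := fun y =>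
    { toFun := f y
      map_add' := fun a b => hinj _ _ (by simp [hf])
      map_smul' := fun c a => hinj _ _ (by simp [hf]) }
  have hF : ∀ y, F y ∈ gammaB K s k m := by
    intro y
    have hexn : ∀ z : nHat K m, ∃ w : nHat K m, ι w = ⁅(y : L), ι z⁆ := fun z => by
      obtain ⟨w, hw, hwz⟩ := exists_mem_nHat_of_leibniz ι
        ((LieAlgebra.ad K L (y : L) : L →ₗ[K] L) ∘ₗ (ι : g →ₗ[K] L)) (fun a b => by simp)
        (fun c hc => ⟨f y ⟨c, hc⟩, LieSubalgebra.subset_lieSpan (f y ⟨c, hc⟩).2, hf y ⟨c, hc⟩⟩) z.2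
      exact ⟨⟨w, hw⟩, hwz⟩
    choose d hd using hexn
    have hinjn : ∀ a b : nHat K m, ι (a : g) = ι (b : g) → a = b :=
      fun a b hab => Subtype.ext (h.injective hab)
    let D : LieDerivation K (nHat K m) (nHat K m) :=
      { toFun := d
        map_add' := fun a b => hinjn _ _ (by simp [hd])
        map_smul' := fun c a => hinjn _ _ (by simp [hd])
        leibniz' := fun a b => hinjn _ _ (by
          simp only [LinearMap.coe_mk, AddHom.coe_mk, AddSubgroupClass.coe_sub,
            LieSubalgebra.coe_bracket, LieHom.map_lie, map_sub, hd, leibniz_lie (y : L)]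
          rw [← lie_skew (ι (b : g)), sub_neg_eq_add, add_comm]) }
    refine ⟨D, fun γ hγ a b hab => h.injective ?_, fun c => h.injective ?_⟩
    · have h1 : ι (γ (d a : g)) = ⁅(y : L), ι (γ (a : g))⁆ := h.gammaOf_comm y.2 hγ a (d a) (hd a)
      rw [hab] at h1
      exact h1.trans (hd b).symm
    · exact (hf y c).trans (hd ⟨(c : g), _⟩).symm
  let G : nullPart K s k L →ₗ[K] gammaB K s k m :=
    { toFun := fun y => ⟨F y, hF y⟩
      map_add' := fun y z => by
        ext c
        exact congrArg Subtype.val (hinj (f (y + z) c) (f y c + f z c) (by simp [hf]))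
      map_smul' := fun a y => by
        ext c
        exact congrArg Subtype.val (hinj (f (a • y) c) (a • f y c) (by simp [hf])) }
  refine LinearMap.finrank_le_finrank_of_injective (f := G) ?_
  refine (injective_iff_map_eq_zero G).mpr fun y hy => ?_
  refine Subtype.ext (h.eq_zero_of_mem_nullPart T y.2 fun c hc => ?_)
  have : f y ⟨c, hc⟩ = 0 := LinearMap.congr_fun (congrArg Subtype.val hy) ⟨c, hc⟩
  rw [← hf y ⟨c, hc⟩, this]
  simp

theorem finrank_le_finrank_prod :
    Module.finrank K L ≤ Module.finrank K (s × gammaB K s k m × m) := by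
  have hfin : FiniteDimensional K g := FiniteDimensional.of_injective (ι : g →ₗ[K] L) h.injective
  rw [← Submodule.finrank_add_eq_of_isCompl (h.isCompl_nullPart_movedPart T), h.movedPart_eq T,
    finrank_prod_gammaB]
  have h1 := h.finrank_nullPart_le T
  have h2 := Submodule.finrank_map_le (ι : g →ₗ[K] L) (s.toSubmodule ⊔ m)
  have h3 : Module.finrank K (s.toSubmodule ⊔ m : Submodule K g) ≤
      Module.finrank K s + Module.finrank K m := Submodule.finrank_add_le_finrank_add_finrank _ _
  omega

end IsSubinvariantEmbedding

namespace IsGammaTriple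

open LieAlgebra

variable {K : Type*} [Field K] {g : Type*} [LieRing g] [LieAlgebra K g]
  {s k : LieSubalgebra K g} {m : Submodule K g} (T : IsGammaTriple K s k m)

/-- The elements of `(Der n̂)^Γ` that preserve `m`. -/
def derCentralizerPreserving (K : Type*) [Field K] {g : Type*} [LieRing g] [LieAlgebra K g]
    (s k : LieSubalgebra K g) (m : Submodule K g) :
    Submodule K (LieDerivation K (nHat K m) (nHat K m)) where
  carrier := {D | D ∈ derCentralizer K s k m ∧
    ∀ x : m, (D ⟨(x : g), LieSubalgebra.subset_lieSpan x.2⟩ : g) ∈ m}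
  zero_mem' := ⟨zero_mem _, fun x => by simp⟩
  add_mem' := fun {a b} ha hb => ⟨add_mem ha.1 hb.1, fun x => add_mem (ha.2 x) (hb.2 x)⟩
  smul_mem' := fun c a ha => ⟨SMulMemClass.smul_mem c ha.1, fun x => m.smul_mem c (ha.2 x)⟩

lemma finrank_gammaB_le [FiniteDimensional K g] : Module.finrank K (gammaB K s k m) ≤
    Module.finrank K (derCentralizerPreserving K s k m) := by
  let ρ : derCentralizerPreserving K s k m →ₗ[K] Module.End K m :=
    { toFun := fun D => LinearMap.codRestrict m ((nHat K m).toSubmodule.subtype ∘ₗ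
        (D : LieDerivation K (nHat K m) (nHat K m)).toLinearMap ∘ₗ
          Submodule.inclusion (p := m) (p' := (nHat K m).toSubmodule)
            fun _ hx => LieSubalgebra.subset_lieSpan hx) D.2.2
      map_add' := fun _ _ => rfl
      map_smul' := fun _ _ => rfl }
  refine (Submodule.finrank_mono (t := LinearMap.range ρ) ?_).trans (LinearMap.finrank_range_le ρ)
  rintro b ⟨D, hD, hb⟩
  refine ⟨⟨D, hD, fun x => ?_⟩, ?_⟩
  · rw [← hb x]
    exact (b x).2
  · ext x
    exact (hb x).symm

include T

/-- The extension of derivations of `n̂` to `C^∞(g)` by zero on the Levi subalgebra. -/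
lemma exists_extension [CharZero K] [FiniteDimensional K g] :
    ∃ E : derCentralizerPreserving K s k m →ₗ[K]
      LieDerivation K (lowerCentralLimit K g) (lowerCentralLimit K g),
      (∀ D (x : lowerCentralLimit K g), (x : g) ∈ s → E D x = 0) ∧
      ∀ D (x : lowerCentralLimit K g) (hx : (x : g) ∈ nHat K m),
        (E D x : g) = ((D : LieDerivation K (nHat K m) (nHat K m)) ⟨x, hx⟩ : nHat K m) := by
  set J := lowerCentralLimit K g with hJ
  have hex : ∀ x : J, ∃ b : nHat K m, (x : g) - b ∈ s := fun x => by
    obtain ⟨a, ha, b, hb, hab⟩ := T.exists_add_eq_of_mem_lowerCentralLimit x.2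
    exact ⟨⟨b, hb⟩, by rw [← hab, add_sub_cancel_right]; exact ha⟩
  choose p hp using hex
  have huniq : ∀ (x : J) (b : nHat K m), (x : g) - b ∈ s → p x = b := fun x b hb => by
    have h1 : (p x : g) - b ∈ s := by
      have := sub_mem hb (hp x)
      rwa [sub_sub_sub_cancel_left] at this
    have h2 := T.eq_zero_of_mem h1 (T.nHat_le_radical (sub_mem (p x).2 b.2))
    exact Subtype.ext (sub_eq_zero.mp h2)
  have hadd : ∀ x y, p (x + y) = p x + p y := fun x y => huniq _ _ (by
    have := add_mem (hp x) (hp y)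
    rwa [show (x : g) - p x + (y - p y) = ((x + y : J) : g) - ((p x + p y : nHat K m) : g) by
      rw [AddMemClass.coe_add, AddMemClass.coe_add]; abel] at this)
  have hsmul : ∀ (c : K) x, p (c • x) = c • p x := fun c x => huniq _ _ (by
    have := SMulMemClass.smul_mem c (hp x)
    rwa [smul_sub] at this)
  have hnJ : ∀ b : nHat K m, (b : g) ∈ J := fun b => T.nHat_mem_lowerCentralLimit b.2
  have hD : ∀ D ∈ derCentralizer K s k m, ∀ a ∈ s, ∀ x y : nHat K m, ⁅a, (x : g)⁆ = y →
      ⁅a, (D x : g)⁆ = D y := fun D hD a ha x y hxy =>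
    hD (LieAlgebra.ad K g a) (Submodule.mem_sup_left (Submodule.subset_span ⟨a, ha, rfl⟩)) x y hxy
  have hsn : ∀ a ∈ s, ∀ b : nHat K m, ⁅a, (b : g)⁆ ∈ nHat K m := fun a ha b =>
    T.lie_mem_nHat (Submodule.mem_sup_left ha) b.2
  let E : derCentralizerPreserving K s k m → LieDerivation K J J := fun D =>
    { toFun := fun x => ⟨((D : LieDerivation K (nHat K m) (nHat K m)) (p x) : nHat K m), hnJ _⟩
      map_add' := fun x y => Subtype.ext (by simp [hadd])
      map_smul' := fun c x => Subtype.ext (by simp [hsmul])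
      leibniz' := fun x y => Subtype.ext (by
        obtain ⟨a, ha⟩ : ∃ a, a = (x : g) - p x := ⟨_, rfl⟩
        obtain ⟨a', ha'⟩ : ∃ a', a' = (y : g) - p y := ⟨_, rfl⟩
        have has : a ∈ s := ha ▸ hp x
        have has' : a' ∈ s := ha' ▸ hp y
        have hx : (x : g) = a + p x := by rw [ha, sub_add_cancel]
        have hy : (y : g) = a' + p y := by rw [ha', sub_add_cancel]
        have hpxy : p ⁅x, y⁆ = ⟨_, hsn a has (p y)⟩ - ⟨_, hsn a' has' (p x)⟩ + ⁅p x, p y⁆ := by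
          refine huniq _ _ ?_
          have h1 : ((⁅x, y⁆ : J) : g) = ⁅(x : g), (y : g)⁆ := rfl
          rw [h1, hx, hy, AddMemClass.coe_add, AddSubgroupClass.coe_sub,
            LieSubalgebra.coe_bracket]
          have h2 : ⁅a + (p x : g), a' + (p y : g)⁆ - (⁅a, (p y : g)⁆ - ⁅a', (p x : g)⁆ +
              ⁅(p x : g), (p y : g)⁆) = ⁅a, a'⁆ := by
            rw [← lie_skew a' (p x : g)]
            simp only [lie_add, add_lie]
            abel
          rw [h2]
          exact s.lie_mem has has'
        have h3 := hD _ D.2.1 a has (p y) ⟨_, hsn a has (p y)⟩ rfl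
        have h4 := hD _ D.2.1 a' has' (p x) ⟨_, hsn a' has' (p x)⟩ rfl
        simp only [LinearMap.coe_mk, AddHom.coe_mk, hpxy, map_add, map_sub,
          LieDerivation.apply_lie_eq_sub, AddSubgroupClass.coe_sub, AddMemClass.coe_add,
          LieSubalgebra.coe_bracket, ← h3, ← h4]
        change _ = ⁅(x : g), _⁆ - ⁅(y : g), _⁆
        rw [hx, hy]
        simp only [add_lie]
        abel) }
  refine ⟨{ toFun := E
            map_add' := fun D D' => rfl
            map_smul' := fun c D => rfl }, fun D x hx => ?_, fun D x hx => ?_⟩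
  · have : p x = 0 := huniq x 0 (by simpa using hx)
    exact Subtype.ext (by
      change (((D : LieDerivation K (nHat K m) (nHat K m)) (p x) : nHat K m) : g) = 0
      rw [this, map_zero]
      rfl)
  · have : p x = ⟨x, hx⟩ := huniq x _ (by simp)
    change (((D : LieDerivation K (nHat K m) (nHat K m)) (p x) : nHat K m) : g) = _
    rw [this]

lemma mem_centralizer_of_commutes [CharZero K] [FiniteDimensional K g]
    {D : LieDerivation K (nHat K m) (nHat K m)} (hD : D ∈ derCentralizer K s k m) {z : g}
    (hz : z ∈ s.toSubmodule ⊔ m) (hzs : ∀ a ∈ s, ⁅a, z⁆ = 0)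
    (hzD : ∀ b : nHat K m, ⁅z, (b : g)⁆ = -(D b : g)) :
    z ∈ lowerCentralLimitCentralizer K g := by
  have hk := T.nilpotent
  have := T.hasTrivialRadical
  let Z := lowerCentralLimitCentralizer K g
  have hu : ∀ x ∈ k, ∀ u v, IsJordanDecomposition (LieAlgebra.ad K g x) u v → u z ∈ Z := by
    intro x hx u v hJ y hy
    obtain ⟨a, ha, b, hb, rfl⟩ := T.exists_add_eq_of_mem_lowerCentralLimit hy
    have ha0 : ⁅a, u z⁆ = 0 := by
      have hc : Commute (LieAlgebra.ad K g a) (LieAlgebra.ad K g x) :=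
        LinearMap.ext fun w => T.lie_lie_comm ⟨a, ha⟩ ⟨x, hx⟩ w
      have := LinearMap.congr_fun (hJ.commute_of_commute hc) z
      rw [Module.End.mul_apply, Module.End.mul_apply, LieAlgebra.ad_apply, LieAlgebra.ad_apply,
        hzs a ha, map_zero] at this
      exact this
    have hb0 : ⁅u z, b⁆ = 0 := by
      have hub : u b ∈ nHat K m := hJ.mem_of_mem (p := (nHat K m).toSubmodule)
        (fun w hw => T.lie_mem_nHat (Submodule.mem_sup_right hx) hw) hb
      have h1 := hJ.apply_lie (fun a b => leibniz_lie x a b) z b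
      have h2 : u (D ⟨b, hb⟩ : g) = (D ⟨u b, hub⟩ : g) :=
        hD u (Submodule.mem_sup_right (Submodule.subset_span
          ⟨x, hx, v, hJ.isSemisimple, hJ.isNilpotent, hJ.commute, hJ.eq_add⟩)) ⟨b, hb⟩ ⟨u b, hub⟩ rfl
      rw [hzD ⟨b, hb⟩, hzD ⟨u b, hub⟩, map_neg, h2] at h1
      exact left_eq_add.mp (by rw [add_comm]; exact h1)
    rw [add_lie, ha0, ← lie_skew, hb0, neg_zero, add_zero]
  have hc := LieModule.isCompl_nullPart_movedPart (K := K) (S := s) (N := k) (V := g ⧸ Z)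
    T.lie_lie_comm
  have hmk : ∀ w, LieSubmodule.Quotient.mk' Z w = 0 ↔ w ∈ Z := fun w =>
    LieSubmodule.Quotient.mk_eq_zero Z
  refine (hmk z).mp (Submodule.disjoint_def.mp hc.disjoint _ ?_
    (map_mem_movedPart (LieSubmodule.Quotient.mk' Z) (T.le_movedPart hz)))
  refine mem_nullPart.mpr ⟨fun a => ?_, ?_⟩
  · have := (LieSubmodule.Quotient.mk' Z).map_lie (a : g) z
    rw [hzs a a.2, map_zero] at this
    exact this.symm
  · rw [mem_genWeightSpace]
    intro x
    obtain ⟨u, v, hJ⟩ := (LieAlgebra.ad K g (x : g)).exists_isJordanDecomposition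
    obtain ⟨u', v', hJ'⟩ := (toEnd K k (g ⧸ Z) x).exists_isJordanDecomposition
    have h0 : u' (LieSubmodule.Quotient.mk' Z z) = 0 := by
      have := hJ.apply_comm hJ' (f := (LieSubmodule.Quotient.mk' Z : g →ₗ[K] g ⧸ Z))
        (fun w => (LieSubmodule.Quotient.mk' Z).map_lie (x : g) w) z
      rw [← LieModuleHom.coe_toLinearMap, ← this]
      exact (hmk _).mpr (hu x x.2 u v hJ)
    obtain ⟨n, hn⟩ := hJ'.pow_apply_eq_zero h0
    exact ⟨n, by simpa using hn⟩

theorem finrank_prod_le [CharZero K] [FiniteDimensional K g] (hZ : center K g = ⊥) :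
    Module.finrank K (s × gammaB K s k m × m) ≤
      Module.finrank K (LieDerivation K (lowerCentralLimit K g) (lowerCentralLimit K g)) +
        Module.finrank K (center K (lowerCentralLimit K g)) := by
  have hid : IsSubinvariantEmbedding (LieHom.id : g →ₗ⁅K⁆ g) :=
    ⟨Function.injective_id, fun _ _ => rfl, ⟨0, fun y _ => ⟨y, rfl⟩⟩, fun y hy => by
      have : y ∈ center K g := (mem_maxTrivSubmodule K g g y).mpr hy
      rwa [hZ, LieSubmodule.mem_bot] at this⟩
  obtain ⟨φ, hφ⟩ := hid.exists_linearMap_derivation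
  replace hφ : ∀ (y : g) (x : lowerCentralLimit K g), (φ y x : g) = ⁅y, (x : g)⁆ := hφ
  obtain ⟨E, hEs, hEn⟩ := T.exists_extension
  let σ : (s × m × derCentralizerPreserving K s k m) →ₗ[K] g :=
    s.toSubmodule.subtype ∘ₗ LinearMap.fst _ _ _ +
      m.subtype ∘ₗ LinearMap.fst _ _ _ ∘ₗ LinearMap.snd _ _ _
  have hσ : ∀ t, σ t = (t.1 : g) + (t.2.1 : g) := fun _ => rfl
  let Ψ : (s × m × derCentralizerPreserving K s k m) →ₗ[K]
      LieDerivation K (lowerCentralLimit K g) (lowerCentralLimit K g) :=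
    φ ∘ₗ σ + E ∘ₗ LinearMap.snd _ _ _ ∘ₗ LinearMap.snd _ _ _
  have hΨ : ∀ t (x : lowerCentralLimit K g), (Ψ t x : g) = ⁅σ t, (x : g)⁆ + (E t.2.2 x : g) :=
    fun t x => by rw [← hφ]; rfl
  have hnJ : ∀ b : nHat K m, (b : g) ∈ lowerCentralLimit K g := fun b =>
    T.nHat_mem_lowerCentralLimit b.2
  have hker : ∀ t, Ψ t = 0 → σ t ∈ lowerCentralLimitCentralizer K g := by
    intro t ht
    refine T.mem_centralizer_of_commutes t.2.2.2.1
      (Submodule.add_mem_sup t.1.2 t.2.1.2) (fun a ha => ?_) (fun b => ?_)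
    · have := hΨ t ⟨a, T.s_mem_lowerCentralLimit ha⟩
      rw [ht, hEs _ _ ha] at this
      rw [← lie_skew, neg_eq_zero]
      simpa using this.symm
    · have := hΨ t ⟨b, hnJ b⟩
      rw [ht, hEn _ _ b.2] at this
      exact eq_neg_of_add_eq_zero_left this.symm
  have hσJ : ∀ t, σ t ∈ lowerCentralLimit K g := fun t =>
    add_mem (T.s_mem_lowerCentralLimit t.1.2)
      (T.nHat_mem_lowerCentralLimit (LieSubalgebra.subset_lieSpan t.2.1.2))
  have hinj : ∀ t, Ψ t = 0 → σ t = 0 → t = 0 := by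
    intro t ht h0
    have h1 : (t.1 : g) = 0 := by
      refine T.eq_zero_of_mem t.1.2 ?_
      have := eq_neg_of_add_eq_zero_left h0
      change (t.1 : g) = -(t.2.1 : g) at this
      rw [this]
      exact neg_mem (T.m_le_radical t.2.1.2)
    have h2 : (t.2.1 : g) = 0 := by
      have := hσ t
      rwa [h0, h1, zero_add, eq_comm] at this
    have h3 : (t.2.2 : LieDerivation K (nHat K m) (nHat K m)) = 0 := by
      ext b
      have := hΨ t ⟨b, hnJ b⟩
      rw [ht, h0, hEn _ _ b.2, zero_lie, zero_add] at this
      exact this.symm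
    exact Prod.ext (Subtype.ext h1) (Prod.ext (Subtype.ext h2) (Subtype.ext h3))
  let χ : LinearMap.ker Ψ →ₗ[K] center K (lowerCentralLimit K g) :=
    { toFun := fun t => ⟨⟨σ t, hσJ t⟩, (mem_maxTrivSubmodule _ _ _ _).mpr fun x =>
        Subtype.ext (hker t t.2 x x.2)⟩
      map_add' := fun t t' => Subtype.ext (Subtype.ext (σ.map_add t t'))
      map_smul' := fun c t => Subtype.ext (Subtype.ext (σ.map_smul c t)) }
  have hχ : Function.Injective χ := (injective_iff_map_eq_zero χ).mpr fun t ht =>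
    Subtype.ext (hinj t t.2 (congrArg
      (fun w : center K (lowerCentralLimit K g) => ((w : lowerCentralLimit K g) : g)) ht))
  have h1 := LinearMap.finrank_range_add_finrank_ker Ψ
  have h2 := LinearMap.finrank_le_finrank_of_injective hχ
  have h3 := Submodule.finrank_le (LinearMap.range Ψ)
  have h4 := finrank_gammaB_le (K := K) (s := s) (k := k) (m := m)
  rw [Module.finrank_prod, Module.finrank_prod] at h1
  rw [finrank_prod_gammaB]
  omega

end IsGammaTriple

theorem mainTheorem9 {K : Type u} [Field K] [CharZero K] {g : Type v} [LieRing g]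
    [LieAlgebra K g] [FiniteDimensional K g] (hZ : LieAlgebra.center K g = ⊥) :
    (∃ N : ℕ, DerivationTowerTerminatesAt K g N) ∧
    ∀ N : ℕ, DerivationTowerTerminatesAt K g N →
      FiniteDimensional K (derivationTower K g N).carrier ∧
      IsCompleteLieAlgebra K (derivationTower K g N).carrier ∧
      (∀ (s k : LieSubalgebra K g) (m : Submodule K g), IsGammaTriple K s k m →
        Module.finrank K (derivationTower K g N).carrier ≤
          Module.finrank K (s × gammaB K s k m × m) ∧
        Module.finrank K (s × gammaB K s k m × m) ≤
          Module.finrank K (LieDerivation K (lowerCentralLimit K g) (lowerCentralLimit K g)) +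
            Module.finrank K (LieAlgebra.center K (lowerCentralLimit K g))) ∧
      Module.finrank K (derivationTower K g N).carrier ≤
        Module.finrank K (LieDerivation K (lowerCentralLimit K g) (lowerCentralLimit K g)) +
          Module.finrank K (LieAlgebra.center K (lowerCentralLimit K g)) := by
  refine ⟨exists_derivationTowerTerminatesAt hZ, fun N hN => ?_⟩
  have hfin := finiteDimensional_derivationTower (K := K) (g := g) N
  obtain ⟨ι, h⟩ := exists_isSubinvariantHom_derivationTower hZ N
  refine ⟨hfin, ⟨h.center_eq_bot, (hN N le_rfl).2⟩, fun s k m T => ⟨?_, T.finrank_prod_le hZ⟩,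
    finrank_derivationTower_le hZ N⟩
  let _ := LieRingModule.compLieHom (derivationTower K g N).carrier ι
  let _ := LieModule.compLieHom (derivationTower K g N).carrier ι
  have := T.nilpotent
  exact IsSubinvariantEmbedding.finrank_le_finrank_prod h T
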